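/- Let $\hbar$ be a formal parameter. Let $T\subset\mathbb C\setminus\{0\}$ and $U\subset\mathbb C\setminus\{0,1\}$ be connected, non-empty open sets. Let $y=\sum_{k\ge 0}y_k(t)\hbar^k$ (with $y_0$ nowhere zero), $z=\sum_{k\ge0}z_k(t)\hbar^k$ and $u=\exp\big(\sum_{k\ge -1}\ell_k(t)\hbar^k\big)$, with coefficients holomorphic on $T$, be a formal solution of the Painlevé 5 system with vanishing monodromy parameters $$-\pi\hbar t\,\dot y=ty-2z(y-1)^2,\qquad -\pi\hbar t\,\dot z=yz^2-\frac{z^2}{y},\qquad -\pi\hbar t\,\frac{d\log u}{dt}=-2z+yz+\frac zy .$$ Consider the Lax pair $-\pi\hbar\,\partial_\xi\Psi=\mathcal D\Psi$, $-\pi\hbar\,\partial_t\Psi=\mathcal R\Psi$ with $$\mathcal D=\begin{pmatrix}\frac t2+\frac z\xi-\frac z{\xi-1}&-\frac{uz}\xi+\frac{uyz}{\xi-1}\\ \frac z{u\xi}-\frac z{(\xi-1)uy}&-\frac t2-\frac z\xi+\frac z{\xi-1}\end{pmatrix},\qquad \mathcal R=\begin{pmatrix}\frac\xi2&\frac{-uz+uyz}{t}\\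 \frac z{tu}-\frac z{tuy}&-\frac\xi2\end{pmatrix},$$ and let $\Psi=\begin{pmatrix}\psi&\phi\\ \tilde\psi&\tilde\phi\end{pmatrix}$ be a formal WKB solution of both equations on $T\times U$, each of whose entries is of the form $$\psi(t,\xi)=\exp\Big(\sum_{k=-1}^{\infty}\psi_k(t,\xi)\hbar^k\Big)$$ (similarly $\phi_k,\tilde\psi_k,\tilde\phi_k$) with $\psi_k,\phi_k,\tilde\psi_k,\tilde\phi_k$ holomorphic on $T\times U$. The spectral curve is $\lim_{\hbar\to0}\det\big(Y-(-\tfrac1\pi)\mathcal D(t,\xi)\big)=0$. Then: 1. For $t\in T$ and $\xi\in\mathbb C\setminus\{0,1\}$ the spectral curve is $Y^2=\dfrac{t^2(2\xi-1)^2}{16\pi^2\,\xi(\xi-1)}$, with a double zero at $\xi=\frac12$. 2. $\partial_\xi\psi_{-1}(t,\xi)=\pm Y(t,\xi)$: for all $(t,\xi)\in T\times U$ the point $(\xi,\partial_\xi\psi_{-1}(t,\xi))$ lies on the spectral curve, and for each $t\in T$ and each holomorphic branch $Y$ of the spectral curve on $U$, either $\partial_\xi\psi_{-1}(t,\cdot)=Y$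 on $U$ or $\partial_\xi\psi_{-1}(t,\cdot)=-Y$ on $U$. 3. There are constants $c_k$ and functions $\psi_k(\xi)$ on $U$ with $\psi_k(t,\xi)=\psi_k(\xi)/t^k+c_k$ for all $k\ge-1$ and $(t,\xi)\in T\times U$ (so that, after normalizing the constants, $\psi=\exp\big(\sum_{k\ge-1}\psi_k(\xi)\hbar^k/t^k\big)$). 4. For every $k\ge-1$, the only possible finite singularities of the functions $\xi\mapsto\psi_k(\xi)$ and $\xi\mapsto\psi_k(t,\xi)$ ($t\in T$) are at $\xi=0$ and $\xi=1$: their germs at points of $U$ continue analytically along every path in $\mathbb C\setminus\{0,1\}$. In particular they are not singular at $\xi=\frac12$. Statements 2–4 hold in the same way for $\phi$, $\tilde\psi$ and $\tilde\phi$. -/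

import Mathlib

open scoped PowerSeries Topology

noncomputable section

namespace PainleveFive

/-- The ring in which formal WKB expressions (at a fixed value of the variables) live: finite sums
of terms `f(ħ) * e^{c/ħ}` with `c : ℂ` and `f : ℂ⟦ħ⟧`. The symbols `e^{c/ħ}` are multiplied by
`e^{c/ħ} * e^{d/ħ} = e^{(c+d)/ħ}` and are linearly independent over `ℂ⟦ħ⟧`, i.e. this is the
group algebra of `(ℂ, +)` over `ℂ⟦ħ⟧`. The formal variable `ħ` is `PowerSeries.X`. -/
abbrev WKBRing : Type := AddMonoidAlgebra ℂ⟦X⟧ ℂ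

/-- The formal exponential `exp (∑_{k ≥ -1} a_k ħ^k)`, where the exponent is given through
`E = ∑_{j ≥ 0} a_{j-1} ħ^j` (so the exponent is `E / ħ`):
it is `e^{a_{-1}/ħ} * exp(a_0) * exp (∑_{k ≥ 1} a_k ħ^k)`. -/
def formalExp (E : ℂ⟦X⟧) : WKBRing :=
  AddMonoidAlgebra.single (PowerSeries.coeff 0 E)
    (PowerSeries.C (Complex.exp (PowerSeries.coeff 1 E)) *
      (PowerSeries.exp ℂ).subst
        (PowerSeries.X * PowerSeries.mk fun k => PowerSeries.coeff (k + 2) E))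

/-- The formal series `∑_j a_j(t) ħ^j`. -/
def ser (a : ℕ → ℂ → ℂ) (t : ℂ) : ℂ⟦X⟧ := PowerSeries.mk fun j => a j t

/-- The termwise derivative `∑_j a_j'(t) ħ^j`. -/
def dser (a : ℕ → ℂ → ℂ) (t : ℂ) : ℂ⟦X⟧ := PowerSeries.mk fun j => deriv (a j) t

/-- `(y, z, u)` is a formal solution, on the time domain `T`, of the Painlevé 5 system with
vanishing monodromy parameters
* `-π ħ t y' = t y - 2 z (y - 1)^2`,
* `-π ħ t z' = y z^2 - z^2 / y`,
* `-π ħ t (log u)' = -2 z + y z + z / y`,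

where `y = ∑_{k ≥ 0} y_k(t) ħ^k` is invertible as a formal series, `z = ∑_{k ≥ 0} z_k(t) ħ^k`, and
`log u = ∑_{k ≥ -1} L_{k+1}(t) ħ^k`. -/
structure IsFormalPainleve (T : Set ℂ) (y z L : ℕ → ℂ → ℂ) : Prop where
  differentiableOn_y : ∀ j, DifferentiableOn ℂ (y j) T
  differentiableOn_z : ∀ j, DifferentiableOn ℂ (z j) T
  differentiableOn_log_u : ∀ j, DifferentiableOn ℂ (L j) T
  y_ne_zero : ∀ t ∈ T, y 0 t ≠ 0
  eq_y : ∀ t ∈ T,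
    PowerSeries.C (-(Real.pi : ℂ) * t) * PowerSeries.X * dser y t =
      PowerSeries.C t * ser y t - 2 * ser z t * (ser y t - 1) ^ 2
  eq_z : ∀ t ∈ T,
    PowerSeries.C (-(Real.pi : ℂ) * t) * PowerSeries.X * dser z t =
      ser y t * ser z t ^ 2 - ser z t ^ 2 * (ser y t)⁻¹
  eq_log_u : ∀ t ∈ T,
    PowerSeries.C (-(Real.pi : ℂ) * t) * dser L t =
      -2 * ser z t + ser y t * ser z t + ser z t * (ser y t)⁻¹

/-- The formal function `u(t) = exp (∑_{k ≥ -1} L_{k+1}(t) ħ^k)`. -/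
def uFun (L : ℕ → ℂ → ℂ) (t : ℂ) : WKBRing := formalExp (ser L t)

/-- The formal function `1 / u(t)`. -/
def uInv (L : ℕ → ℂ → ℂ) (t : ℂ) : WKBRing := formalExp (-ser L t)

/-- The Lax matrix `𝓓(t, ξ)` of the `ξ`-equation (vanishing monodromies). -/
def laxD (y z L : ℕ → ℂ → ℂ) (t ξ : ℂ) : Matrix (Fin 2) (Fin 2) WKBRing :=
  !![(PowerSeries.C (t / 2) + PowerSeries.C (1 / ξ) * ser z t
        - PowerSeries.C (1 / (ξ - 1)) * ser z t) • (1 : WKBRing),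
     (-PowerSeries.C (1 / ξ) * ser z t
        + PowerSeries.C (1 / (ξ - 1)) * ser y t * ser z t) • uFun L t;
     (PowerSeries.C (1 / ξ) * ser z t
        - PowerSeries.C (1 / (ξ - 1)) * ser z t * (ser y t)⁻¹) • uInv L t,
     (-PowerSeries.C (t / 2) - PowerSeries.C (1 / ξ) * ser z t
        + PowerSeries.C (1 / (ξ - 1)) * ser z t) • (1 : WKBRing)]

/-- The Lax matrix `𝓡(t, ξ)` of the `t`-equation (vanishing monodromies). -/
def laxR (y z L : ℕ → ℂ → ℂ) (t ξ : ℂ) : Matrix (Fin 2) (Fin 2) WKBRing :=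
  !![PowerSeries.C (ξ / 2) • (1 : WKBRing),
     (PowerSeries.C (1 / t) * (-ser z t + ser y t * ser z t)) • uFun L t;
     (PowerSeries.C (1 / t) * (ser z t - ser z t * (ser y t)⁻¹)) • uInv L t,
     PowerSeries.C (-ξ / 2) • (1 : WKBRing)]

/-- The matrix `Ψ(t, ξ)` of WKB wave functions with entries
`Ψ_{ab}(t, ξ) = exp (∑_{k ≥ -1} S_{a b (k+1)}(t, ξ) ħ^k)`; thus the coefficient of `ħ^k` in the
exponent is `S a b (k + 1)`, and `ψ, φ` (resp. `ψ̃, φ̃`) are the entries of the first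
(resp. second) row. -/
def waveMatrix (S : Fin 2 → Fin 2 → ℕ → ℂ → ℂ → ℂ) (t ξ : ℂ) :
    Matrix (Fin 2) (Fin 2) WKBRing :=
  Matrix.of fun a b => formalExp (PowerSeries.mk fun j => S a b j t ξ)

/-- `ħ ∂Ψ/∂ξ`: the termwise derivative, `ħ ∂_ξ exp(E/ħ) = (∂_ξ E) exp(E/ħ)`. -/
def hbarDerivXi (S : Fin 2 → Fin 2 → ℕ → ℂ → ℂ → ℂ) (t ξ : ℂ) :
    Matrix (Fin 2) (Fin 2) WKBRing :=
  Matrix.of fun a b =>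
    (PowerSeries.mk fun j => deriv (fun x => S a b j t x) ξ) • waveMatrix S t ξ a b

/-- `ħ ∂Ψ/∂t`: the termwise derivative, `ħ ∂_t exp(E/ħ) = (∂_t E) exp(E/ħ)`. -/
def hbarDerivT (S : Fin 2 → Fin 2 → ℕ → ℂ → ℂ → ℂ) (t ξ : ℂ) :
    Matrix (Fin 2) (Fin 2) WKBRing :=
  Matrix.of fun a b =>
    (PowerSeries.mk fun j => deriv (fun τ => S a b j τ ξ) t) • waveMatrix S t ξ a b

/-- The matrix with entries `exp (∑_{k ≥ -1} S_{a b (k+1)}(t, ξ) ħ^k)`, whose coefficients are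
holomorphic on `T × U`, is a WKB solution of the Lax pair
`-π ħ ∂Ψ/∂ξ = 𝓓 Ψ`, `-π ħ ∂Ψ/∂t = 𝓡 Ψ`. -/
structure IsWKBSolution (T U : Set ℂ) (y z L : ℕ → ℂ → ℂ)
    (S : Fin 2 → Fin 2 → ℕ → ℂ → ℂ → ℂ) : Prop where
  differentiableOn : ∀ a b j,
    DifferentiableOn ℂ (fun p : ℂ × ℂ => S a b j p.1 p.2) (T ×ˢ U)
  eq_xi : ∀ t ∈ T, ∀ ξ ∈ U,
    (PowerSeries.C (-(Real.pi : ℂ)) : ℂ⟦X⟧) • hbarDerivXi S t ξ =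
      laxD y z L t ξ * waveMatrix S t ξ
  eq_t : ∀ t ∈ T, ∀ ξ ∈ U,
    (PowerSeries.C (-(Real.pi : ℂ)) : ℂ⟦X⟧) • hbarDerivT S t ξ =
      laxR y z L t ξ * waveMatrix S t ξ

/-- The formal expression `a` is a power series in `ħ` (no exponential `e^{c/ħ}`, `c ≠ 0`,
occurs) and its limit as `ħ → 0` is `c`. -/
def HasHbarLimit (a : WKBRing) (c : ℂ) : Prop :=
  ∃ f : ℂ⟦X⟧, a = f • (1 : WKBRing) ∧ PowerSeries.constantCoeff f = c

/-- The point `(ξ, Y)` lies on the spectral curve `lim_{ħ → 0} det (Y - (-1/π) 𝓓(t, ξ)) = 0`. -/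
def OnSpectralCurve (y z L : ℕ → ℂ → ℂ) (t ξ Y : ℂ) : Prop :=
  HasHbarLimit
    (Matrix.det ((PowerSeries.C Y : ℂ⟦X⟧) • (1 : Matrix (Fin 2) (Fin 2) WKBRing)
      - (PowerSeries.C (-1 / (Real.pi : ℂ)) : ℂ⟦X⟧) • laxD y z L t ξ)) 0

/-- The germ of `f` at `a` has an analytic continuation along the path `γ`: a family of germs of
analytic functions `F s` at the points `γ s`, locally given by one and the same function, that
starts with `f`. -/
def ContinuesAlong (f : ℂ → ℂ) {a b : ℂ} (γ : Path a b) : Prop :=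
  ∃ F : unitInterval → ℂ → ℂ,
    F 0 =ᶠ[𝓝 a] f ∧ (∀ s, AnalyticAt ℂ (F s) (γ s)) ∧
      ∀ s, ∀ᶠ s' in 𝓝 s, F s' =ᶠ[𝓝 (γ s')] F s

/-- The only finite singularities of the (in general multivalued) function obtained from `f`, which
is given on `U`, by analytic continuation are located in `P`: every germ of `f` at a
point of `U` continues analytically along every path in the complex plane avoiding `P`. -/
def SingularOnlyAt (P : Set ℂ) (f : ℂ → ℂ) (U : Set ℂ) : Prop :=
  ∀ a ∈ U, ∀ b : ℂ, ∀ γ : Path a b, (∀ s, γ s ∉ P) → ContinuesAlong f γ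

end PainleveFive

end

/-!
Elimination of one row of the Lax pair through the ratio of the two entries of a column leads to a
Riccati equation with respect to `t`, which, unlike the spectral curve, does not degenerate at
`ξ = 1/2`.

*The Painlevé solution.* The leading terms are forced to be `y₀ = -1`, `z₀ = -t/8`, and the
linearization there is invertible. Hence the formal solution is unique and therefore homogeneous:
`y` and `z / t` are series in `ħ / t` with constant coefficients
(`IsFormalPainleve.homogeneous`). The formula for the spectral curve follows
(`onSpectralCurve_iff`).

*The ratio.* In a column `(ψ, ψ̃)` put `w = u ψ̃ / ψ`. Comparing exponentials in the `t`-equation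
shows that `w` is a power series in `ħ` (`smul_formalExp_eq`). The Lax pair expresses `∂_t log ψ`
and `∂_ξ log ψ` through `w`, and its `t`-part gives a Riccati equation for `w`. The leading term
`ω` satisfies `ω² + 2 (2ξ - 1) ω + 1 = 0`, so that `r = ω + 2ξ - 1` is a root of
`r² = 4 ξ (ξ - 1)`; the linearization of the Riccati equation is a constant multiple of `r`, which
has no zero on `U`. Thus `w` is again unique once `ω` is chosen, hence a series in `ħ / t`
(`IsRowSolution.exists_ratio`), and its coefficients are polynomials in `ξ`, `r` and `1 / r`.
The second row is the same with `1 / w` in place of `w`; the sign `σ = ±1` covers both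
(`IsRowCoeff`, `IsRowSolution`).

*Separation of variables.* The coefficient of `ħ^{j-1}` in `log ψ` has `t`-derivative
`f_j(ξ) t^{-j}` and `ξ`-derivative `h_j(ξ) t^{1-j}`. For `j ≠ 1` this integrates to
`f_j(ξ) t^{1-j} / (1 - j)` plus a constant (`exists_eq_mul_zpow_add`). For `j = 1` a logarithm of
`t` could occur, but the explicit second coefficients of `y`, `z` and `w` give `f_1 = 0`.

*Singularities.* The square root `r` continues along every path avoiding `0` and `1`, without
zeros (`exists_sqrt_germFamily`, by lifting through the covering `exp`), hence so do all
coefficients with `j ≠ 1`. The remaining one is `-½ log (ω r)` up to a constant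
(`exists_exp_coeff_one`), where `ω r` has no zero along the path either.
-/

/-! ### The formal exponential as an additive-to-multiplicative map -/

namespace PainleveFive

open PowerSeries

theorem constantCoeff_exp_subst {f : ℂ⟦X⟧} (hf : constantCoeff f = 0) :
    constantCoeff ((exp ℂ).subst f) = 1 := by
  have h1 : (exp ℂ) = (exp ℂ - 1) + 1 := by ring
  have hs := HasSubst.of_constantCoeff_zero' hf
  have h2 : constantCoeff ((exp ℂ - 1).subst f) = 0 :=
    constantCoeff_subst_eq_zero hf _ (by simp)
  have h3 : (1 : ℂ⟦X⟧).subst f = 1 := by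
    rw [← coe_substAlgHom hs]; exact map_one _
  rw [h1, subst_add hs, map_add, h2, h3]
  simp

theorem derivative_exp_subst {f : ℂ⟦X⟧} (hf : constantCoeff f = 0) :
    d⁄dX ℂ ((exp ℂ).subst f) = (exp ℂ).subst f * d⁄dX ℂ f := by
  rw [derivative_subst (HasSubst.of_constantCoeff_zero' hf), derivative_exp]

/-- Uniqueness for the formal linear equation `P' = P h`. -/
theorem eq_zero_of_derivative_eq_mul {P h : ℂ⟦X⟧} (h0 : constantCoeff P = 0)
    (hd : d⁄dX ℂ P = P * h) : P = 0 := by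
  ext n
  induction n using Nat.strong_induction_on with
  | _ n ih =>
    cases n with
    | zero => simpa using h0
    | succ n =>
      have h1 := congrArg (coeff n) hd
      rw [coeff_derivative, coeff_mul, Finset.sum_eq_zero] at h1
      · have : ((n : ℂ) + 1) ≠ 0 := by exact_mod_cast Nat.succ_ne_zero n
        simpa [this] using h1
      · rintro ⟨i, j⟩ hij
        have := Finset.HasAntidiagonal.mem_antidiagonal.1 hij
        simp only at this ⊢
        rw [ih i (by omega)]
        simp

theorem exp_subst_add {f g : ℂ⟦X⟧} (hf : constantCoeff f = 0) (hg : constantCoeff g = 0) :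
    (exp ℂ).subst (f + g) = (exp ℂ).subst f * (exp ℂ).subst g := by
  have hfg : constantCoeff (f + g) = 0 := by simp [hf, hg]
  rw [← sub_eq_zero]
  apply eq_zero_of_derivative_eq_mul (h := d⁄dX ℂ f + d⁄dX ℂ g)
  · simp [constantCoeff_exp_subst, hf, hg]
  · rw [map_sub, Derivation.leibniz, derivative_exp_subst hfg, derivative_exp_subst hf,
      derivative_exp_subst hg, map_add]
    simp only [smul_eq_mul]
    ring

/-- The power series factor of `formalExp E`: the exponential of all terms of `E / ħ` except the
leading one `E₀ / ħ`. -/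
noncomputable def expFactor (E : ℂ⟦X⟧) : ℂ⟦X⟧ :=
  C (Complex.exp (coeff 1 E)) * (exp ℂ).subst (X * mk fun k => coeff (k + 2) E)

theorem formalExp_eq_single (E : ℂ⟦X⟧) :
    formalExp E = AddMonoidAlgebra.single (coeff 0 E) (expFactor E) := rfl

theorem constantCoeff_expFactor (E : ℂ⟦X⟧) :
    constantCoeff (expFactor E) = Complex.exp (coeff 1 E) := by
  rw [expFactor, map_mul, constantCoeff_exp_subst (by simp)]
  simp

theorem expFactor_ne_zero (E : ℂ⟦X⟧) : expFactor E ≠ 0 := by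
  intro h
  have := constantCoeff_expFactor E
  rw [h, map_zero] at this
  exact Complex.exp_ne_zero _ this.symm

theorem expFactor_add (E F : ℂ⟦X⟧) : expFactor (E + F) = expFactor E * expFactor F := by
  have : (X * mk fun k => coeff (k + 2) (E + F) : ℂ⟦X⟧) =
      (X * mk fun k => coeff (k + 2) E) + X * mk fun k => coeff (k + 2) F := by
    rw [← mul_add]; rfl
  rw [expFactor, this, exp_subst_add (by simp) (by simp), map_add, Complex.exp_add, map_mul,
    expFactor, expFactor]
  ring

theorem expFactor_zero : expFactor 0 = 1 := by
  have h := expFactor_add 0 0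
  rw [add_zero] at h
  exact (mul_eq_left₀ (expFactor_ne_zero 0)).1 h.symm

theorem expFactor_mul_neg (E : ℂ⟦X⟧) : expFactor E * expFactor (-E) = 1 := by
  rw [← expFactor_add, add_neg_cancel, expFactor_zero]

theorem formalExp_add (E F : ℂ⟦X⟧) : formalExp (E + F) = formalExp E * formalExp F := by
  rw [formalExp_eq_single, formalExp_eq_single, formalExp_eq_single,
    AddMonoidAlgebra.single_mul_single, expFactor_add, map_add]

theorem formalExp_zero : formalExp 0 = 1 := by
  rw [formalExp_eq_single, expFactor_zero, map_zero]; rfl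

/-- In a relation between two formal exponentials with a non-vanishing coefficient, both the
exponents of `e^{c/ħ}` and the power series factors agree. -/
theorem smul_formalExp_eq {p c E F : ℂ⟦X⟧} (hc : c ≠ 0)
    (h : p • formalExp E = c • formalExp F) :
    coeff 0 E = coeff 0 F ∧ p = c * expFactor (F - E) := by
  rw [formalExp_eq_single, formalExp_eq_single, AddMonoidAlgebra.smul_single,
    AddMonoidAlgebra.smul_single, smul_eq_mul, smul_eq_mul] at h
  have h' := congrArg AddMonoidAlgebra.coeff h
  simp only [AddMonoidAlgebra.coeff_single] at h'
  have hne : c * expFactor F ≠ 0 := mul_ne_zero hc (expFactor_ne_zero F)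
  rcases (Finsupp.single_eq_single_iff _ _ _ _).1 h' with ⟨h1, h2⟩ | ⟨-, h2⟩
  · refine ⟨h1, mul_right_cancel₀ (expFactor_ne_zero E) ?_⟩
    rw [h2, mul_assoc, ← expFactor_add, sub_add_cancel]
  · exact absurd h2 hne

/-- Reading off a power series identity from one row of the Lax pair. -/
theorem smul_formalExp_row {q d c E F K : ℂ⟦X⟧}
    (h : q • formalExp E = (d • (1 : WKBRing)) * formalExp E + (c • formalExp K) * formalExp F) :
    q = d + c * expFactor (K + F - E) := by
  rw [smul_mul_assoc, one_mul, smul_mul_assoc, ← formalExp_add, ← sub_eq_iff_eq_add',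
    ← sub_smul] at h
  rcases eq_or_ne c 0 with rfl | hc
  · rw [zero_smul, formalExp_eq_single, AddMonoidAlgebra.smul_single,
      AddMonoidAlgebra.single_eq_zero, smul_eq_mul] at h
    have := (mul_eq_zero.1 h).resolve_right (expFactor_ne_zero E)
    rw [zero_mul, add_zero]
    exact sub_eq_zero.1 this
  · rw [← sub_eq_iff_eq_add']
    exact (smul_formalExp_eq hc h).2

theorem smul_formalExp_row_coeff_zero {q d c E F K : ℂ⟦X⟧} (hc : c ≠ 0)
    (h : q • formalExp E = (d • (1 : WKBRing)) * formalExp E + (c • formalExp K) * formalExp F) :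
    coeff 0 K + coeff 0 F = coeff 0 E := by
  rw [smul_mul_assoc, one_mul, smul_mul_assoc, ← formalExp_add, ← sub_eq_iff_eq_add',
    ← sub_smul] at h
  rw [(smul_formalExp_eq hc h).1, map_add]

/-! ### Termwise derivatives of families of power series -/

/-- The family of formal series `f` has termwise derivative `f'` at `t`. -/
def HasSeriesDerivAt (f : ℂ → ℂ⟦X⟧) (f' : ℂ⟦X⟧) (t : ℂ) : Prop :=
  ∀ n, HasDerivAt (fun τ => coeff n (f τ)) (coeff n f') t

namespace HasSeriesDerivAt

variable {f g : ℂ → ℂ⟦X⟧} {f' g' : ℂ⟦X⟧} {t : ℂ}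

theorem add (hf : HasSeriesDerivAt f f' t) (hg : HasSeriesDerivAt g g' t) :
    HasSeriesDerivAt (fun τ => f τ + g τ) (f' + g') t := fun n => by
  simpa using (hf n).fun_add (hg n)

theorem sub (hf : HasSeriesDerivAt f f' t) (hg : HasSeriesDerivAt g g' t) :
    HasSeriesDerivAt (fun τ => f τ - g τ) (f' - g') t := fun n => by
  simpa using (hf n).fun_sub (hg n)

theorem neg (hf : HasSeriesDerivAt f f' t) :
    HasSeriesDerivAt (fun τ => -f τ) (-f') t := fun n => by
  simpa using (hf n).fun_neg

theorem exp_subst (h0 : ∀ τ, constantCoeff (f τ) = 0) (hf : HasSeriesDerivAt f f' t) :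
    HasSeriesDerivAt (fun τ => (exp ℂ).subst (f τ)) ((exp ℂ).subst (f t) * f') t := by
  have hf'0 : constantCoeff f' = 0 := by
    have h := hf 0
    simp only [coeff_zero_eq_constantCoeff, h0] at h
    exact h.unique (hasDerivAt_const t (0 : ℂ))
  intro n
  induction n using Nat.strong_induction_on with
  | _ n ih =>
    cases n with
    | zero =>
      simp only [coeff_zero_eq_constantCoeff, constantCoeff_exp_subst (h0 _), map_mul, hf'0,
        mul_zero]
      exact hasDerivAt_const t (1 : ℂ)
    | succ n =>
      -- differentiate the recursion `(n + 1) P_{n+1} = ∑ P_i (j + 1) f_{j+1}` for `P = exp ∘ f`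
      have hne : ((n : ℂ) + 1) ≠ 0 := by exact_mod_cast Nat.succ_ne_zero n
      have hrec : ∀ τ, coeff (n + 1) ((exp ℂ).subst (f τ)) =
          (∑ p ∈ Finset.HasAntidiagonal.antidiagonal n, coeff p.1 ((exp ℂ).subst (f τ)) *
            (coeff (p.2 + 1) (f τ) * ((p.2 : ℂ) + 1))) / ((n : ℂ) + 1) := fun τ => by
        have h1 := congrArg (coeff n) (derivative_exp_subst (h0 τ))
        rw [coeff_derivative, coeff_mul] at h1
        simp only [coeff_derivative] at h1
        rw [eq_div_iff hne, h1]
      have hder : coeff (n + 1) ((exp ℂ).subst (f t) * f') =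
          (∑ p ∈ Finset.HasAntidiagonal.antidiagonal n,
            (coeff p.1 ((exp ℂ).subst (f t) * f') * (coeff (p.2 + 1) (f t) * ((p.2 : ℂ) + 1)) +
             coeff p.1 ((exp ℂ).subst (f t)) * (coeff (p.2 + 1) f' * ((p.2 : ℂ) + 1))))
            / ((n : ℂ) + 1) := by
        have h1 : d⁄dX ℂ ((exp ℂ).subst (f t) * f') =
            ((exp ℂ).subst (f t) * f') * d⁄dX ℂ (f t) + (exp ℂ).subst (f t) * d⁄dX ℂ f' := by
          rw [Derivation.leibniz, derivative_exp_subst (h0 t)]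
          simp only [smul_eq_mul]; ring
        have h2 := congrArg (coeff n) h1
        rw [coeff_derivative, map_add, coeff_mul _ _ (d⁄dX ℂ (f t)), coeff_mul _ _ (d⁄dX ℂ f'),
          ← Finset.sum_add_distrib] at h2
        simp only [coeff_derivative] at h2
        rw [eq_div_iff hne, h2]
      simp only [hrec]
      rw [hder]
      refine HasDerivAt.div_const (HasDerivAt.fun_sum fun p hp => ?_) _
      have hp' := Finset.HasAntidiagonal.mem_antidiagonal.1 hp
      exact (ih p.1 (by omega)).mul ((hf (p.2 + 1)).mul_const _)

/-- The derivative of the power series factor: of `∂ exp(E/ħ) = (E'/ħ) exp(E/ħ)` the term `E₀'/ħ`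
is left out, since it belongs to the factor `e^{E₀/ħ}`. -/
theorem expFactor (hf : HasSeriesDerivAt f f' t) :
    HasSeriesDerivAt (fun τ => expFactor (f τ))
      (expFactor (f t) * mk fun k => coeff (k + 1) f') t := by
  have hsub : HasSeriesDerivAt (fun τ => (X * mk fun k => coeff (k + 2) (f τ) : ℂ⟦X⟧))
      (X * mk fun k => coeff (k + 2) f') t := by
    intro n
    cases n with
    | zero => simpa using hasDerivAt_const t (0 : ℂ)
    | succ n => simpa [coeff_succ_X_mul] using hf (n + 2)
  have h1 := hsub.exp_subst (fun τ => by simp)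
  have hsplit : (mk fun k => coeff (k + 1) f' : ℂ⟦X⟧) =
      C (coeff 1 f') + X * mk fun k => coeff (k + 2) f' := by
    ext n
    cases n with
    | zero => simp
    | succ n => simp [coeff_succ_X_mul]
  intro n
  have h2 := ((hf 1).cexp).mul (h1 n)
  simp only [PainleveFive.expFactor, coeff_C_mul, mul_assoc]
  refine h2.congr_deriv ?_
  rw [hsplit, mul_add, map_add, mul_comm _ (C _), coeff_C_mul]
  ring

end HasSeriesDerivAt

end PainleveFive

/-! ### Analytic continuation along paths -/

namespace PainleveFive

open Filter

/-- A compatible family of analytic germs along the path `γ`. -/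
structure IsGermFamily {a b : ℂ} (γ : Path a b) (F : unitInterval → ℂ → ℂ) : Prop where
  analyticAt : ∀ s, AnalyticAt ℂ (F s) (γ s)
  eventually_eq : ∀ s, ∀ᶠ s' in 𝓝 s, F s' =ᶠ[𝓝 (γ s')] F s

theorem continuesAlong_iff {f : ℂ → ℂ} {a b : ℂ} {γ : Path a b} :
    ContinuesAlong f γ ↔ ∃ F, F 0 =ᶠ[𝓝 a] f ∧ IsGermFamily γ F :=
  ⟨fun ⟨F, h0, h1, h2⟩ => ⟨F, h0, h1, h2⟩, fun ⟨F, h0, h⟩ => ⟨F, h0, h.1, h.2⟩⟩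

namespace IsGermFamily

variable {a b : ℂ} {γ : Path a b} {F G : unitInterval → ℂ → ℂ}

theorem of_analytic {f : ℂ → ℂ} (hf : ∀ x, AnalyticAt ℂ f x) : IsGermFamily γ fun _ => f :=
  ⟨fun _ => hf _, fun _ => .of_forall fun _ => .rfl⟩

theorem add (hF : IsGermFamily γ F) (hG : IsGermFamily γ G) :
    IsGermFamily γ fun s x => F s x + G s x :=
  ⟨fun s => (hF.1 s).add (hG.1 s), fun s => by
    filter_upwards [hF.2 s, hG.2 s] with s' h1 h2 using h1.add h2⟩

theorem mul (hF : IsGermFamily γ F) (hG : IsGermFamily γ G) :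
    IsGermFamily γ fun s x => F s x * G s x :=
  ⟨fun s => (hF.1 s).mul (hG.1 s), fun s => by
    filter_upwards [hF.2 s, hG.2 s] with s' h1 h2 using h1.mul h2⟩

theorem comp {g : ℂ → ℂ} (hg : ∀ x, AnalyticAt ℂ g x) (hF : IsGermFamily γ F) :
    IsGermFamily γ fun s x => g (F s x) :=
  ⟨fun s => (hg _).comp (hF.1 s), fun s => by
    filter_upwards [hF.2 s] with s' h1 using h1.fun_comp g⟩

theorem continuous_value (hF : IsGermFamily γ F) : Continuous fun s => F s (γ s) := by
  rw [continuous_iff_continuousAt]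
  intro s
  have h1 : ContinuousAt (fun s' => F s (γ s')) s :=
    ContinuousAt.comp (f := γ) (hF.1 s).continuousAt γ.continuous.continuousAt
  refine h1.congr ?_
  filter_upwards [hF.2 s] with s' h using h.eq_of_nhds.symm

end IsGermFamily

/-- A function tending to `0` whose exponential is `1` vanishes eventually. -/
theorem eventually_eq_zero_of_exp_eq_one {α : Type*} {l : Filter α} {k : α → ℂ}
    (hk : Tendsto k l (𝓝 0)) (he : ∀ᶠ x in l, Complex.exp (k x) = 1) : ∀ᶠ x in l, k x = 0 := by
  have hball : ∀ᶠ x in l, k x ∈ Metric.ball (0 : ℂ) 1 :=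
    hk (Metric.ball_mem_nhds _ one_pos)
  filter_upwards [hball, he] with x h1 h2
  obtain ⟨n, hn⟩ := Complex.exp_eq_one_iff.1 h2
  have h3 : ‖k x‖ < 1 := by simpa using h1
  rw [hn] at h3 ⊢
  have h4 : ‖(n : ℂ) * (2 * Real.pi * Complex.I)‖ = |(n : ℝ)| * (2 * Real.pi) := by
    simp [abs_of_pos Real.pi_pos]
  rw [h4] at h3
  have h5 : n = 0 := by
    by_contra h0
    have h6 : (1 : ℝ) ≤ |(n : ℝ)| := by exact_mod_cast Int.one_le_abs h0
    nlinarith [Real.pi_gt_three]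
  simp [h5]

/-- A continuous lift of a nowhere vanishing function on the unit interval through `exp`. -/
theorem exists_continuous_log {g : unitInterval → ℂ} (hg : Continuous g) (h0 : ∀ s, g s ≠ 0)
    {e : ℂ} (he : Complex.exp e = g 0) :
    ∃ l : unitInterval → ℂ, Continuous l ∧ (∀ s, Complex.exp (l s) = g s) ∧ l 0 = e := by
  obtain ⟨Γ, h1, h2⟩ := Complex.isCoveringMap_exp.exists_path_lifts
    ⟨fun s => (⟨g s, h0 s⟩ : {z : ℂ // z ≠ 0}), hg.subtype_mk _⟩ e (Subtype.ext he.symm)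
  exact ⟨Γ, Γ.continuous, fun s => congrArg Subtype.val (congrFun h1 s), h2⟩

/-- A logarithm of a nowhere vanishing germ family: analytic continuation of `f` along `γ` from
that of `exp f`. The branch over `γ s` is normalized through a continuous lift of the values. -/
theorem IsGermFamily.exists_log {a b : ℂ} {γ : Path a b} {G : unitInterval → ℂ → ℂ}
    (hG : IsGermFamily γ G) (h0 : ∀ s, G s (γ s) ≠ 0) {f : ℂ → ℂ} (hf : AnalyticAt ℂ f a)
    (hfG : ∀ᶠ x in 𝓝 a, Complex.exp (f x) = G 0 x) :
    ∃ F, F 0 =ᶠ[𝓝 a] f ∧ IsGermFamily γ F ∧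
      ∀ s, ∀ᶠ x in 𝓝 (γ s), Complex.exp (F s x) = G s x := by
  have hval0 : Complex.exp (f a) = G 0 (γ 0) := by
    rw [γ.source]; exact hfG.self_of_nhds
  obtain ⟨l, hlc, hle, hl0⟩ := exists_continuous_log hG.continuous_value h0 hval0
  set F : unitInterval → ℂ → ℂ := fun s x => l s + Complex.log (G s x / G s (γ s)) with hF
  have hslit : ∀ s, G s (γ s) / G s (γ s) ∈ Complex.slitPlane := fun s => by
    rw [div_self (h0 s)]; exact Complex.one_mem_slitPlane
  have han : ∀ s, AnalyticAt ℂ (F s) (γ s) := fun s =>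
    analyticAt_const.add (((hG.1 s).div_const).clog (hslit s))
  have hself : ∀ s, F s (γ s) = l s := fun s => by
    simp [hF, div_self (h0 s)]
  have hexp : ∀ s, ∀ᶠ x in 𝓝 (γ s), Complex.exp (F s x) = G s x := fun s => by
    filter_upwards [(hG.1 s).continuousAt.eventually_ne (h0 s)] with x hx
    rw [hF, Complex.exp_add, hle, Complex.exp_log (div_ne_zero hx (h0 s)),
      mul_div_cancel₀ _ (h0 s)]
  -- two analytic logarithms of the same germ with the same value coincide
  have hunique : ∀ (p : ℂ) (f₁ f₂ : ℂ → ℂ), ContinuousAt f₁ p → ContinuousAt f₂ p →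
      f₁ p = f₂ p → (∀ᶠ x in 𝓝 p, Complex.exp (f₁ x) = Complex.exp (f₂ x)) → f₁ =ᶠ[𝓝 p] f₂ := by
    intro p f₁ f₂ h1 h2 h12 he
    have ht : Tendsto (fun x => f₁ x - f₂ x) (𝓝 p) (𝓝 0) := by
      have := h1.tendsto.sub h2.tendsto
      rwa [h12, sub_self] at this
    have h3 := eventually_eq_zero_of_exp_eq_one ht (by
      filter_upwards [he] with x hx
      rw [Complex.exp_sub, hx, div_self (Complex.exp_ne_zero _)])
    filter_upwards [h3] with x hx using sub_eq_zero.1 hx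
  refine ⟨F, ?_, ⟨han, fun s => ?_⟩, hexp⟩
  · refine hunique a _ _ ?_ hf.continuousAt ?_ ?_
    · have := (han 0).continuousAt; rwa [γ.source] at this
    · have := hself 0; rw [γ.source] at this; rw [this, hl0]
    · have := hexp 0; rw [γ.source] at this
      filter_upwards [this, hfG] with x h1 h2 using h1.trans h2.symm
  · have hγ : Tendsto γ (𝓝 s) (𝓝 (γ s)) := γ.continuous.continuousAt
    -- the values at nearby points of the path agree
    have hvals : ∀ᶠ s' in 𝓝 s, l s' - F s (γ s') = 0 := by
      refine eventually_eq_zero_of_exp_eq_one ?_ ?_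
      · have h1 : Tendsto (fun s' => F s (γ s')) (𝓝 s) (𝓝 (F s (γ s))) :=
          (han s).continuousAt.tendsto.comp hγ
        have := (hlc.tendsto s).sub h1
        rwa [hself, sub_self] at this
      · filter_upwards [hγ.eventually (hexp s), hG.2 s] with s' h1 h2
        rw [Complex.exp_sub, h1, hle, h2.eq_of_nhds, div_self]
        rw [← h2.eq_of_nhds]; exact h0 s'
    filter_upwards [hvals, hG.2 s, hγ.eventually (hexp s).eventually_nhds,
      hγ.eventually (han s).eventually_analyticAt] with s' h1 h2 h3 h4
    refine hunique _ _ _ (han s').continuousAt h4.continuousAt ?_ ?_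
    · rw [hself, ← sub_eq_zero, h1]
    · filter_upwards [hexp s', h2, h3] with x e1 e2 e3
      rw [e1, e2, e3]

namespace ContinuesAlong

variable {a b : ℂ} {γ : Path a b} {f g : ℂ → ℂ}

theorem congr (hf : ContinuesAlong f γ) (h : f =ᶠ[𝓝 a] g) : ContinuesAlong g γ := by
  obtain ⟨F, h0, h1⟩ := hf
  exact ⟨F, h0.trans h, h1⟩

theorem of_analytic (hf : ∀ x, AnalyticAt ℂ f x) : ContinuesAlong f γ :=
  continuesAlong_iff.2 ⟨_, .rfl, .of_analytic hf⟩

theorem const (c : ℂ) : ContinuesAlong (fun _ => c) γ := of_analytic fun _ => analyticAt_const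

theorem id : ContinuesAlong (fun x => x) γ := of_analytic fun _ => analyticAt_id

theorem add (hf : ContinuesAlong f γ) (hg : ContinuesAlong g γ) :
    ContinuesAlong (fun x => f x + g x) γ := by
  rw [continuesAlong_iff] at *
  obtain ⟨F, hF0, hF⟩ := hf
  obtain ⟨G, hG0, hG⟩ := hg
  exact ⟨_, hF0.add hG0, hF.add hG⟩

theorem mul (hf : ContinuesAlong f γ) (hg : ContinuesAlong g γ) :
    ContinuesAlong (fun x => f x * g x) γ := by
  rw [continuesAlong_iff] at *
  obtain ⟨F, hF0, hF⟩ := hf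
  obtain ⟨G, hG0, hG⟩ := hg
  exact ⟨_, hF0.mul hG0, hF.mul hG⟩

theorem const_mul (c : ℂ) (hf : ContinuesAlong f γ) : ContinuesAlong (fun x => c * f x) γ :=
  (const c).mul hf

theorem sub (hf : ContinuesAlong f γ) (hg : ContinuesAlong g γ) :
    ContinuesAlong (fun x => f x - g x) γ := by
  simpa [sub_eq_add_neg] using hf.add (hg.const_mul (-1))

theorem sum {ι : Type*} {s : Finset ι} {f : ι → ℂ → ℂ} (h : ∀ i ∈ s, ContinuesAlong (f i) γ) :
    ContinuesAlong (fun x => ∑ i ∈ s, f i x) γ := by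
  classical
  induction s using Finset.induction_on with
  | empty => simpa using const 0
  | insert i s hi ih =>
    simp only [Finset.sum_insert hi]
    exact (h i (by simp)).add (ih fun j hj => h j (by simp [hj]))

end ContinuesAlong

/-- All coefficients of the family of formal series `P` continue analytically along `γ`. -/
def SeriesContinuesAlong (P : ℂ → ℂ⟦X⟧) {a b : ℂ} (γ : Path a b) : Prop :=
  ∀ n, ContinuesAlong (fun x => PowerSeries.coeff n (P x)) γ

namespace SeriesContinuesAlong

variable {a b : ℂ} {γ : Path a b} {P Q : ℂ → ℂ⟦X⟧}

theorem const (p : ℂ⟦X⟧) : SeriesContinuesAlong (fun _ => p) γ := fun _ => .const _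

theorem C {f : ℂ → ℂ} (hf : ContinuesAlong f γ) :
    SeriesContinuesAlong (fun x => PowerSeries.C (f x)) γ := fun n => by
  cases n with
  | zero => simpa using hf
  | succ n => simpa [PowerSeries.coeff_C] using ContinuesAlong.const (γ := γ) 0

theorem add (hP : SeriesContinuesAlong P γ) (hQ : SeriesContinuesAlong Q γ) :
    SeriesContinuesAlong (fun x => P x + Q x) γ := fun n => by
  simpa using (hP n).add (hQ n)

theorem sub (hP : SeriesContinuesAlong P γ) (hQ : SeriesContinuesAlong Q γ) :
    SeriesContinuesAlong (fun x => P x - Q x) γ := fun n => by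
  simpa using (hP n).sub (hQ n)

theorem mul (hP : SeriesContinuesAlong P γ) (hQ : SeriesContinuesAlong Q γ) :
    SeriesContinuesAlong (fun x => P x * Q x) γ := fun n => by
  simp only [PowerSeries.coeff_mul]
  exact ContinuesAlong.sum fun p _ => (hP p.1).mul (hQ p.2)

end SeriesContinuesAlong

/-- The square root `2 √(ξ (ξ - 1))` continues along every path avoiding `0` and `1`, without
zeros on the way. -/
theorem exists_sqrt_germFamily {a b : ℂ} {γ : Path a b} (hγ : ∀ s, γ s ∉ ({0, 1} : Set ℂ))
    {r : ℂ → ℂ} (hr : AnalyticAt ℂ r a) (hr2 : ∀ᶠ x in 𝓝 a, r x ^ 2 = 4 * (x * (x - 1))) :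
    ∃ R, R 0 =ᶠ[𝓝 a] r ∧ IsGermFamily γ R ∧ (∀ s, R s (γ s) ^ 2 = 4 * (γ s * (γ s - 1))) ∧
      (∀ s, R s (γ s) ≠ 0) ∧ ContinuesAlong (fun x => (r x)⁻¹) γ := by
  have hne : ∀ s, 4 * (γ s * (γ s - 1)) ≠ 0 := fun s => by
    have := hγ s
    simp only [Set.mem_insert_iff, Set.mem_singleton_iff, not_or] at this
    exact mul_ne_zero (by norm_num) (mul_ne_zero this.1 (sub_ne_zero.2 this.2))
  have hra : r a ≠ 0 := by
    intro h
    have h1 := hr2.self_of_nhds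
    have h2 := hne 0
    rw [γ.source] at h2
    exact h2 (by rw [← h1, h]; ring)
  set f : ℂ → ℂ := fun x => Complex.log (r a) + Complex.log (r x / r a) with hf
  have hfan : AnalyticAt ℂ f a := analyticAt_const.add (hr.div_const.clog (by
    rw [div_self hra]; exact Complex.one_mem_slitPlane))
  have hfe : ∀ᶠ x in 𝓝 a, Complex.exp (f x) = r x := by
    filter_upwards [hr.continuousAt.eventually_ne hra] with x hx
    rw [hf, Complex.exp_add, Complex.exp_log hra, Complex.exp_log (div_ne_zero hx hra),
      mul_div_cancel₀ _ hra]
  have hG : IsGermFamily γ fun _ x => 4 * (x * (x - 1)) :=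
    .of_analytic fun x => by fun_prop
  obtain ⟨F, hF0, hF, hFe⟩ := hG.exists_log hne (f := fun x => 2 * f x)
      (analyticAt_const.mul hfan) (by
    filter_upwards [hfe, hr2] with x h1 h2
    rw [← h2, two_mul, Complex.exp_add, h1, sq])
  have hhalf : ∀ x : ℂ, AnalyticAt ℂ (fun z : ℂ => Complex.exp (z / 2)) x := fun x => by fun_prop
  have hhalf' : ∀ x : ℂ, AnalyticAt ℂ (fun z : ℂ => Complex.exp (-(z / 2))) x :=
    fun x => by fun_prop
  refine ⟨fun s x => Complex.exp (F s x / 2), ?_,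
    hF.comp (g := fun z => Complex.exp (z / 2)) hhalf, fun s => ?_,
    fun s => Complex.exp_ne_zero _, continuesAlong_iff.2 ⟨_, ?_,
    hF.comp (g := fun z => Complex.exp (-(z / 2))) hhalf'⟩⟩
  · filter_upwards [hF0, hfe] with x h1 h2
    rw [h1, ← h2, mul_div_cancel_left₀ _ two_ne_zero]
  · rw [← Complex.exp_nat_mul, ← (hFe s).self_of_nhds]
    congr 1; push_cast; ring
  · filter_upwards [hF0, hfe] with x h1 h2
    rw [h1, ← h2, mul_div_cancel_left₀ _ two_ne_zero, Complex.exp_neg]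

end PainleveFive

/-! ### Homogeneous formal series -/

namespace PainleveFive

open PowerSeries

theorem eq_of_forall_X_pow_dvd {f g : ℂ⟦X⟧} (h : ∀ k : ℕ, X ^ k ∣ f - g) : f = g := by
  ext n
  have := X_pow_dvd_iff.1 (h (n + 1)) n (Nat.lt_succ_self n)
  rwa [map_sub, sub_eq_zero] at this

theorem X_pow_succ_dvd_of_constantCoeff {f a : ℂ⟦X⟧} {k : ℕ} (h : f = X ^ k * a)
    (h0 : constantCoeff a = 0) : X ^ (k + 1) ∣ f := by
  obtain ⟨b, rfl⟩ := X_dvd_iff.2 h0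
  exact ⟨b, by rw [h]; ring⟩

theorem rescale_inv_rescale {t : ℂ} (ht : t ≠ 0) (f : ℂ⟦X⟧) :
    rescale t⁻¹ (rescale t f) = f := by
  rw [rescale_rescale, mul_inv_cancel₀ ht, rescale_one]; rfl

theorem rescale_rescale_inv {t : ℂ} (ht : t ≠ 0) (f : ℂ⟦X⟧) :
    rescale t (rescale t⁻¹ f) = f := by
  rw [rescale_rescale, inv_mul_cancel₀ ht, rescale_one]; rfl

theorem rescale_C (t c : ℂ) : rescale t (C c) = C c := by
  ext n
  cases n with
  | zero => simp
  | succ n => simp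

theorem rescale_inv_series {f : ℂ⟦X⟧} (hf : constantCoeff f ≠ 0) (t : ℂ) :
    (rescale t f)⁻¹ = rescale t f⁻¹ := by
  have h0 : constantCoeff (rescale t f) ≠ 0 := by
    rwa [← coeff_zero_eq_constantCoeff, coeff_rescale, pow_zero, one_mul,
      coeff_zero_eq_constantCoeff]
  symm
  rw [PowerSeries.eq_inv_iff_mul_eq_one h0, ← map_mul, PowerSeries.inv_mul_cancel _ hf, map_one]

theorem constantCoeff_rescale (t : ℂ) (f : ℂ⟦X⟧) :
    constantCoeff (rescale t f) = constantCoeff f := by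
  rw [← coeff_zero_eq_constantCoeff, coeff_rescale, pow_zero, one_mul]

/-- Euler's relation for a homogeneous function of degree `-m`. -/
theorem euler_homogeneous {T : Set ℂ} (hT : IsOpen T) (hT0 : (0 : ℂ) ∉ T) {f : ℂ → ℂ}
    {f' c : ℂ} {m : ℤ} {t : ℂ} (ht : t ∈ T) (hf : HasDerivAt f f' t)
    (hc : ∀ τ ∈ T, τ ^ m * f τ = c) : t ^ m * t * f' = -m * c := by
  have ht0 : t ≠ 0 := fun h => hT0 (h ▸ ht)
  have h1 := (hasDerivAt_zpow m t (Or.inl ht0)).fun_mul hf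
  have h2 : HasDerivAt (fun τ => τ ^ m * f τ) 0 t :=
    (hasDerivAt_const t c).congr_of_eventuallyEq <| by
      filter_upwards [hT.mem_nhds ht] with τ hτ using hc τ hτ
  have h3 := h1.unique h2
  rw [zpow_sub_one₀ ht0] at h3
  rw [← hc t ht]
  field_simp at h3
  linear_combination h3

/-- Euler's relation up to order `k`, for a family of formal series that is homogeneous up to
order `k` when `t` and `ħ` have the same weight. -/
theorem X_pow_dvd_euler {T : Set ℂ} (hT : IsOpen T) (hT0 : (0 : ℂ) ∉ T) {f f' : ℂ → ℂ⟦X⟧}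
    (hf : ∀ t ∈ T, HasSeriesDerivAt f (f' t) t) {d : ℤ} {F : ℂ⟦X⟧} {k : ℕ}
    (h : ∀ t ∈ T, X ^ k ∣ C (t ^ d) * rescale t (f t) - F) {t : ℂ} (ht : t ∈ T) :
    X ^ k ∣ C (t ^ d * t) * rescale t (f' t) + (X * d⁄dX ℂ F + C (d : ℂ) * F) := by
  rw [X_pow_dvd_iff]
  intro n hn
  have hne : ∀ τ ∈ T, τ ≠ 0 := fun τ hτ h => hT0 (h ▸ hτ)
  have h1 := euler_homogeneous (m := d + n) (c := coeff n F) hT hT0 ht (hf t ht n) fun τ hτ => by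
    have := X_pow_dvd_iff.1 (h τ hτ) n hn
    rw [map_sub, sub_eq_zero, coeff_C_mul, coeff_rescale] at this
    rw [← this, zpow_add₀ (hne τ hτ), zpow_natCast]; ring
  have h2 : coeff n (X * d⁄dX ℂ F) = n * coeff n F := by
    cases n with
    | zero => simp
    | succ n => rw [coeff_succ_X_mul, coeff_derivative]; push_cast; ring
  rw [map_add, map_add, coeff_C_mul, coeff_C_mul, coeff_rescale, h2]
  rw [zpow_add₀ (hne t ht), zpow_natCast] at h1
  push_cast at h1
  linear_combination h1

/-! ### The formal solution of the Painlevé system -/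

/-- One step of the uniqueness of the formal solution of the scaled Painlevé system: the
linearization at `(-1, -1/8)` is invertible. -/
theorem painleve_unique_step {Y Y' Z Z' P P' Q Q' : ℂ⟦X⟧} {k : ℕ} {κ : ℂ}
    (hY : constantCoeff Y = -1) (hY' : constantCoeff Y' = -1)
    (hZ : constantCoeff Z = -1 / 8) (hZ' : constantCoeff Z' = -1 / 8)
    (e1 : C κ * X * P = Y - 2 * Z * (Y - 1) ^ 2)
    (e1' : C κ * X * P' = Y' - 2 * Z' * (Y' - 1) ^ 2)
    (e2 : C κ * X * Q * Y = (Y ^ 2 - 1) * Z ^ 2)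
    (e2' : C κ * X * Q' * Y' = (Y' ^ 2 - 1) * Z' ^ 2)
    (dY : X ^ k ∣ Y - Y') (dZ : X ^ k ∣ Z - Z') (dP : X ^ k ∣ P - P') (dQ : X ^ k ∣ Q - Q') :
    X ^ (k + 1) ∣ Y - Y' ∧ X ^ (k + 1) ∣ Z - Z' := by
  obtain ⟨a, ha⟩ := dY
  obtain ⟨b, hb⟩ := dZ
  obtain ⟨p, hp⟩ := dP
  obtain ⟨q, hq⟩ := dQ
  have hX : (X ^ k : ℂ⟦X⟧) ≠ 0 := pow_ne_zero _ X_ne_zero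
  have E1 : C κ * X * p = a * (1 - 2 * Z * (Y + Y' - 2)) - 2 * b * (Y' - 1) ^ 2 := by
    refine mul_left_cancel₀ hX ?_
    linear_combination e1 - e1' - C κ * X * hp + (1 - 2 * Z * (Y + Y' - 2)) * ha
      - 2 * (Y' - 1) ^ 2 * hb
  have E2 : C κ * X * (q * Y + Q' * a) = a * (Y + Y') * Z ^ 2 + (Y' ^ 2 - 1) * b * (Z + Z') := by
    refine mul_left_cancel₀ hX ?_
    linear_combination e2 - e2' - C κ * X * Y * hq - C κ * X * Q' * ha
      + (Y + Y') * Z ^ 2 * ha + (Y' ^ 2 - 1) * (Z + Z') * hb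
  have C1 := congrArg constantCoeff E1
  have C2 := congrArg constantCoeff E2
  simp only [map_mul, map_add, map_sub, map_pow, map_one, map_ofNat, constantCoeff_X,
    hY, hY', hZ, hZ'] at C1 C2
  have ha0 : constantCoeff a = 0 := by linear_combination 32 * C2
  have hb0 : constantCoeff b = 0 := by linear_combination (1 / 8) * C1
  exact ⟨X_pow_succ_dvd_of_constantCoeff ha ha0, X_pow_succ_dvd_of_constantCoeff hb hb0⟩

theorem hasSeriesDerivAt_ser {T : Set ℂ} (hT : IsOpen T) {y : ℕ → ℂ → ℂ}
    (hy : ∀ j, DifferentiableOn ℂ (y j) T) {t : ℂ} (ht : t ∈ T) :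
    HasSeriesDerivAt (ser y) (dser y t) t := fun n => by
  simpa [ser, dser] using ((hy n).differentiableAt (hT.mem_nhds ht)).hasDerivAt

/-- The formal solution of the Painlevé system is unique and hence homogeneous: `y` and `z / t` are
power series in `ħ / t` with constant coefficients. The values of the first two coefficients are
those that enter the WKB analysis. -/
theorem IsFormalPainleve.homogeneous {T : Set ℂ} (hT : IsOpen T) (hTn : T.Nonempty)
    (hT0 : (0 : ℂ) ∉ T) {y z L : ℕ → ℂ → ℂ} (hP : IsFormalPainleve T y z L) :
    ∃ Y Z : ℂ⟦X⟧, constantCoeff Y = -1 ∧ constantCoeff Z = -1 / 8 ∧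
      coeff 1 Y = 4 * Real.pi ∧ coeff 1 Z = 0 ∧
      ∀ t ∈ T, ser y t = rescale t⁻¹ Y ∧ ser z t = C t * rescale t⁻¹ Z := by
  obtain ⟨t₀, ht₀⟩ := hTn
  have hne : ∀ τ ∈ T, τ ≠ 0 := fun τ hτ h => hT0 (h ▸ hτ)
  set κ : ℂ := -(Real.pi : ℂ) with hκ
  set Yh : ℂ → ℂ⟦X⟧ := fun t => C (t ^ (0 : ℤ)) * rescale t (ser y t) with hYh
  set Zh : ℂ → ℂ⟦X⟧ := fun t => C (t ^ (-1 : ℤ)) * rescale t (ser z t) with hZh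
  set P : ℂ → ℂ⟦X⟧ := fun t => C (t ^ (0 : ℤ) * t) * rescale t (dser y t) with hPd
  set Q : ℂ → ℂ⟦X⟧ := fun t => C (t ^ (-1 : ℤ) * t) * rescale t (dser z t) with hQd
  have hYh' : ∀ t, Yh t = rescale t (ser y t) := fun t => by simp [hYh]
  have hZh' : ∀ t ∈ T, rescale t (ser z t) = C t * Zh t := fun t ht => by
    simp only [hZh]
    rw [← mul_assoc, ← map_mul, zpow_neg_one, mul_inv_cancel₀ (hne t ht), map_one, one_mul]
  have e1 : ∀ t ∈ T, C κ * X * P t = Yh t - 2 * Zh t * (Yh t - 1) ^ 2 := fun t ht => by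
    have h := congrArg (rescale t) (hP.eq_y t ht)
    have hCt : (C t : ℂ⟦X⟧) ≠ 0 := by simpa using hne t ht
    simp only [map_mul, map_sub, map_pow, map_one, map_ofNat, rescale_C, rescale_X, hZh' t ht,
      ← hYh'] at h
    refine mul_left_cancel₀ hCt ?_
    simp only [hPd, zpow_zero, one_mul]
    rw [← hκ] at h
    linear_combination h
  have e2 : ∀ t ∈ T, C κ * X * Q t * Yh t = (Yh t ^ 2 - 1) * Zh t ^ 2 := fun t ht => by
    have hy0 : constantCoeff (ser y t) ≠ 0 := by simpa [ser] using hP.y_ne_zero t ht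
    have h0 : C (-(Real.pi : ℂ) * t) * X * dser z t * ser y t =
        (ser y t ^ 2 - 1) * ser z t ^ 2 := by
      have hi := PowerSeries.inv_mul_cancel _ hy0
      linear_combination ser y t * hP.eq_z t ht - ser z t ^ 2 * hi
    have h := congrArg (rescale t) h0
    have hCt : (C t : ℂ⟦X⟧) ≠ 0 := by simpa using hne t ht
    simp only [map_mul, map_sub, map_pow, map_one, rescale_C, rescale_X, hZh' t ht,
      ← hYh'] at h
    have hQt : Q t = rescale t (dser z t) := by
      simp only [hQd, zpow_neg_one, inv_mul_cancel₀ (hne t ht), map_one, one_mul]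
    refine mul_left_cancel₀ (pow_ne_zero 2 hCt) ?_
    rw [hQt]
    rw [← hκ] at h
    linear_combination h
  have hYZ0 : ∀ t ∈ T, constantCoeff (Yh t) = -1 ∧ constantCoeff (Zh t) = -1 / 8 := by
    intro t ht
    have hy0 : constantCoeff (Yh t) ≠ 0 := by
      rw [hYh', constantCoeff_rescale]; simpa [ser] using hP.y_ne_zero t ht
    have C1 := congrArg constantCoeff (e1 t ht)
    have C2 := congrArg constantCoeff (e2 t ht)
    simp only [map_mul, map_sub, map_pow, map_one, map_ofNat, constantCoeff_X, mul_zero,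
      zero_mul] at C1 C2
    generalize constantCoeff (Yh t) = u at *
    generalize constantCoeff (Zh t) = v at *
    have hv : v ≠ 0 := by
      rintro rfl
      exact hy0 (by linear_combination -C1)
    have hu1 : u - 1 ≠ 0 := by
      intro h
      exact hy0 (by linear_combination -C1 + 2 * v * (u - 1) * h)
    have h1 : (u - 1) * (u + 1) = 0 := by
      refine (mul_eq_zero.1 (?_ : ((u - 1) * (u + 1)) * v ^ 2 = 0)).resolve_right
        (pow_ne_zero 2 hv)
      linear_combination -C2
    have hu : u = -1 := by
      linear_combination (mul_eq_zero.1 h1).resolve_left hu1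
    refine ⟨hu, ?_⟩
    rw [hu] at C1
    linear_combination (1 / 8) * C1
  have hdy : ∀ t ∈ T, HasSeriesDerivAt (ser y) (dser y t) t := fun t ht =>
    hasSeriesDerivAt_ser hT hP.differentiableOn_y ht
  have hdz : ∀ t ∈ T, HasSeriesDerivAt (ser z) (dser z t) t := fun t ht =>
    hasSeriesDerivAt_ser hT hP.differentiableOn_z ht
  have key : ∀ k : ℕ, ∀ t ∈ T, X ^ k ∣ Yh t - Yh t₀ ∧ X ^ k ∣ Zh t - Zh t₀ := by
    intro k
    induction k with
    | zero => intro t _; simp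
    | succ k ih =>
      intro t ht
      have hp := fun τ hτ => X_pow_dvd_euler hT hT0 hdy (fun s hs => (ih s hs).1) (t := τ) hτ
      have hq := fun τ hτ => X_pow_dvd_euler hT hT0 hdz (fun s hs => (ih s hs).2) (t := τ) hτ
      refine painleve_unique_step (hYZ0 t ht).1 (hYZ0 t₀ ht₀).1 (hYZ0 t ht).2 (hYZ0 t₀ ht₀).2
        (e1 t ht) (e1 t₀ ht₀) (e2 t ht) (e2 t₀ ht₀) (ih t ht).1 (ih t ht).2 ?_ ?_
      · exact add_sub_add_right_eq_sub (P t) _ _ ▸ dvd_sub (hp t ht) (hp t₀ ht₀)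
      · exact add_sub_add_right_eq_sub (Q t) _ _ ▸ dvd_sub (hq t ht) (hq t₀ ht₀)
  have hYeq : ∀ t ∈ T, Yh t = Yh t₀ := fun t ht => eq_of_forall_X_pow_dvd fun k => (key k t ht).1
  have hZeq : ∀ t ∈ T, Zh t = Zh t₀ := fun t ht => eq_of_forall_X_pow_dvd fun k => (key k t ht).2
  obtain ⟨hY0, hZ0⟩ := hYZ0 t₀ ht₀
  -- the constant terms of the Euler derivatives
  have hP0 : constantCoeff (P t₀) = 0 := by
    have h := X_pow_dvd_iff.1 (X_pow_dvd_euler hT hT0 hdy (d := 0) (F := Yh t₀) (k := 1)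
      (fun s hs => (key 1 s hs).1) ht₀) 0 one_pos
    simpa [hPd] using h
  have hQ0 : constantCoeff (Q t₀) = -1 / 8 := by
    have h := X_pow_dvd_iff.1 (X_pow_dvd_euler hT hT0 hdz (d := -1) (F := Zh t₀) (k := 1)
      (fun s hs => (key 1 s hs).2) ht₀) 0 one_pos
    rw [coeff_zero_eq_constantCoeff] at h
    have h' : constantCoeff (Q t₀ + (X * d⁄dX ℂ (Zh t₀) + C (((-1 : ℤ)) : ℂ) * Zh t₀)) = 0 := h
    simp only [map_add, map_mul, constantCoeff_X, zero_mul, zero_add, constantCoeff_C, hZ0] at h'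
    push_cast at h'
    linear_combination h'
  have h1 := congrArg (coeff 1) (e1 t₀ ht₀)
  have h2 := congrArg (coeff 1) (e2 t₀ ht₀)
  have two1 : coeff 1 (2 : ℂ⟦X⟧) = 0 := by
    have : (2 : ℂ⟦X⟧) = C 2 := (map_ofNat C 2).symm
    rw [this, coeff_C]; simp
  simp only [mul_assoc, coeff_C_mul, coeff_succ_X_mul, sub_mul, sq, mul_sub, map_sub,
    coeff_one_mul, map_mul, hY0, hZ0, hP0, hQ0, coeff_zero_eq_constantCoeff, two1,
    map_ofNat, mul_one, one_mul] at h1 h2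
  rw [hκ] at h2
  refine ⟨Yh t₀, Zh t₀, hY0, hZ0, ?_, ?_, fun t ht => ⟨?_, ?_⟩⟩
  · linear_combination 32 * h2
  · linear_combination (1 / 8) * h1
  · rw [← hYeq t ht, hYh', rescale_inv_rescale (hne t ht)]
  · rw [← hZeq t ht, ← rescale_inv_rescale (hne t ht) (ser z t), hZh' t ht, map_mul, rescale_C]

end PainleveFive

/-! ### Separation of variables from the two partial derivatives -/

namespace PainleveFive

open PowerSeries

theorem differentiableAt_slice_left {T U : Set ℂ} (hT : IsOpen T) (hU : IsOpen U) {S : ℂ → ℂ → ℂ}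
    (hS : DifferentiableOn ℂ (fun p : ℂ × ℂ => S p.1 p.2) (T ×ˢ U)) {t ξ : ℂ} (ht : t ∈ T)
    (hξ : ξ ∈ U) : DifferentiableAt ℂ (fun τ => S τ ξ) t := by
  have h1 : DifferentiableAt ℂ (fun p : ℂ × ℂ => S p.1 p.2) (t, ξ) :=
    hS.differentiableAt ((hT.prod hU).mem_nhds ⟨ht, hξ⟩)
  exact DifferentiableAt.comp t (f := fun τ => (τ, ξ)) h1 (by fun_prop)

theorem differentiableAt_slice_right {T U : Set ℂ} (hT : IsOpen T) (hU : IsOpen U)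
    {S : ℂ → ℂ → ℂ} (hS : DifferentiableOn ℂ (fun p : ℂ × ℂ => S p.1 p.2) (T ×ˢ U)) {t ξ : ℂ}
    (ht : t ∈ T) (hξ : ξ ∈ U) : DifferentiableAt ℂ (fun x => S t x) ξ := by
  have h1 : DifferentiableAt ℂ (fun p : ℂ × ℂ => S p.1 p.2) (t, ξ) :=
    hS.differentiableAt ((hT.prod hU).mem_nhds ⟨ht, hξ⟩)
  exact DifferentiableAt.comp ξ (f := fun x => (t, x)) h1 (by fun_prop)

/-- A non-constant power of `t` takes two values on an open set. -/
theorem exists_zpow_ne {T : Set ℂ} (hT : IsOpen T) (hT0 : (0 : ℂ) ∉ T) {m : ℤ}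
    (hm : m ≠ 0) {t₁ : ℂ} (ht₁ : t₁ ∈ T) : ∃ t₂ ∈ T, t₁ ^ m ≠ t₂ ^ m := by
  by_contra! h
  have hne : t₁ ≠ 0 := fun h => hT0 (h ▸ ht₁)
  have h1 := hasDerivAt_zpow m t₁ (Or.inl hne)
  have h2 : HasDerivAt (fun τ => τ ^ m) 0 t₁ :=
    (hasDerivAt_const t₁ (t₁ ^ m)).congr_of_eventuallyEq <| by
      filter_upwards [hT.mem_nhds ht₁] with τ hτ using (h τ hτ).symm
  exact mul_ne_zero (Int.cast_ne_zero.2 hm) (zpow_ne_zero _ hne) (h1.unique h2)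

/-- If `∂_t S = m s(ξ) t^{m-1}` and `∂_ξ S = h(ξ) t^m` with `m ≠ 0`, then `S = s(ξ) t^m` up to a
constant. The integration constant is `(t₁^m S(t₂, ξ) - t₂^m S(t₁, ξ)) / (t₁^m - t₂^m)`. -/
theorem exists_eq_mul_zpow_add {T U : Set ℂ} (hT : IsOpen T) (hTc : IsConnected T)
    (hT0 : (0 : ℂ) ∉ T) (hU : IsOpen U) (hUc : IsConnected U) {S : ℂ → ℂ → ℂ}
    (hS : DifferentiableOn ℂ (fun p : ℂ × ℂ => S p.1 p.2) (T ×ˢ U)) {m : ℤ} (hm : m ≠ 0)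
    {s h : ℂ → ℂ}
    (hSt : ∀ t ∈ T, ∀ ξ ∈ U, deriv (fun τ => S τ ξ) t = m * s ξ * t ^ (m - 1))
    (hSξ : ∀ t ∈ T, ∀ ξ ∈ U, deriv (fun x => S t x) ξ = h ξ * t ^ m) :
    ∃ c : ℂ, ∀ t ∈ T, ∀ ξ ∈ U, S t ξ = s ξ * t ^ m + c := by
  obtain ⟨t₁, ht₁⟩ := hTc.nonempty
  obtain ⟨t₂, ht₂, h12⟩ := exists_zpow_ne hT hT0 hm ht₁
  have hne : ∀ τ ∈ T, τ ≠ 0 := fun τ hτ h => hT0 (h ▸ hτ)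
  have hconst : ∀ ξ ∈ U, ∃ k, ∀ t ∈ T, S t ξ - s ξ * t ^ m = k := by
    intro ξ hξ
    have hd : ∀ t ∈ T, HasDerivAt (fun τ => S τ ξ - s ξ * τ ^ m) 0 t := fun t ht => by
      have h1 := (differentiableAt_slice_left hT hU hS ht hξ).hasDerivAt
      have h2 := (hasDerivAt_zpow m t (Or.inl (hne t ht))).const_mul (s ξ)
      refine (h1.fun_sub h2).congr_deriv ?_
      rw [hSt t ht ξ hξ]; ring
    exact hT.exists_is_const_of_deriv_eq_zero hTc.isPreconnected
      (fun t ht => (hd t ht).differentiableAt.differentiableWithinAt)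
      (fun t ht => (hd t ht).deriv)
  have hK : ∃ c, ∀ ξ ∈ U, t₁ ^ m * S t₂ ξ - t₂ ^ m * S t₁ ξ = c := by
    have hd : ∀ ξ ∈ U, HasDerivAt (fun x => t₁ ^ m * S t₂ x - t₂ ^ m * S t₁ x) 0 ξ :=
      fun ξ hξ => by
        have h1 := (differentiableAt_slice_right hT hU hS ht₁ hξ).hasDerivAt
        have h2 := (differentiableAt_slice_right hT hU hS ht₂ hξ).hasDerivAt
        refine ((h2.const_mul (t₁ ^ m)).fun_sub (h1.const_mul (t₂ ^ m))).congr_deriv ?_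
        rw [hSξ t₁ ht₁ ξ hξ, hSξ t₂ ht₂ ξ hξ]; ring
    exact hU.exists_is_const_of_deriv_eq_zero hUc.isPreconnected
      (fun t ht => (hd t ht).differentiableAt.differentiableWithinAt)
      (fun t ht => (hd t ht).deriv)
  obtain ⟨c, hc⟩ := hK
  refine ⟨c / (t₁ ^ m - t₂ ^ m), fun t ht ξ hξ => ?_⟩
  obtain ⟨k, hk⟩ := hconst ξ hξ
  have h0 := hk t ht
  have h1 := hk t₁ ht₁
  have h2 := hk t₂ ht₂
  rw [← hc ξ hξ, ← sub_eq_iff_eq_add', h0, eq_div_iff (sub_ne_zero.2 h12)]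
  linear_combination t₂ ^ m * h1 - t₁ ^ m * h2

/-! ### One row of the Lax pair -/

/-- The coefficients of the scaled equations for one row; `σ = 1` for the first row and `σ = -1`
for the second one. Only the first two terms of the coefficients matter explicitly. -/
structure IsRowCoeff (σ : ℂ) (A B G : ℂ⟦X⟧) (N M : ℂ → ℂ⟦X⟧) : Prop where
  sigma_sq : σ ^ 2 = 1
  A_zero : constantCoeff A = σ / 4
  A_one : coeff 1 A = -(Real.pi : ℂ) / 2
  B_zero : constantCoeff B = -σ / 4
  B_one : coeff 1 B = -(Real.pi : ℂ) / 2
  G_zero : constantCoeff G = 1 / 2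
  G_one : coeff 1 G = 0
  N_zero : ∀ ξ, ξ ≠ 0 → ξ ≠ 1 →
    constantCoeff (N ξ) = σ * (2 * ξ - 1) ^ 2 / (8 * (ξ * (ξ - 1)))
  N_one : ∀ ξ, coeff 1 (N ξ) = 0
  M_zero : ∀ ξ, ξ ≠ 0 → ξ ≠ 1 →
    constantCoeff (M ξ) = σ * (2 * ξ - 1) / (8 * (ξ * (ξ - 1)))
  M_one : ∀ ξ, ξ ≠ 0 → ξ ≠ 1 → coeff 1 (M ξ) = -(Real.pi : ℂ) / (2 * (ξ - 1))

/-- The equations for the exponent `E` of an entry of the wave matrix, in terms of the ratio `w`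
of the other entry of its column (times a power of `u`) to it. -/
structure IsRowSolution (T U : Set ℂ) (σ : ℂ) (A B G : ℂ⟦X⟧) (N M : ℂ → ℂ⟦X⟧)
    (E : ℕ → ℂ → ℂ → ℂ) (w : ℂ → ℂ → ℂ⟦X⟧) : Prop where
  differentiableOn : ∀ j, DifferentiableOn ℂ (fun p : ℂ × ℂ => E j p.1 p.2) (T ×ˢ U)
  eq_t : ∀ t ∈ T, ∀ ξ ∈ U, C (-(Real.pi : ℂ)) * mk (fun j => deriv (fun τ => E j τ ξ) t) =
    C (σ * ξ / 2) + rescale t⁻¹ A * w t ξ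
  eq_xi : ∀ t ∈ T, ∀ ξ ∈ U, C (-(Real.pi : ℂ)) * mk (fun j => deriv (fun x => E j t x) ξ) =
    C t * (rescale t⁻¹ (N ξ) + rescale t⁻¹ (M ξ) * w t ξ)
  riccati : ∀ t ∈ T, ∀ ξ ∈ U, ∃ w', HasSeriesDerivAt (fun τ => w τ ξ) w' t ∧
    C (-(Real.pi : ℂ)) * X * w' =
      C σ * (rescale t⁻¹ G - C ξ) * w t ξ + rescale t⁻¹ B - rescale t⁻¹ A * w t ξ ^ 2
  ratio_ne_zero : ∀ t ∈ T, ∀ ξ ∈ U, constantCoeff (w t ξ) ≠ 0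
  ratio_differentiableOn :
    DifferentiableOn ℂ (fun p : ℂ × ℂ => constantCoeff (w p.1 p.2)) (T ×ˢ U)

variable {T U : Set ℂ} {σ : ℂ} {A B G : ℂ⟦X⟧} {N M : ℂ → ℂ⟦X⟧} {E : ℕ → ℂ → ℂ → ℂ}
  {w : ℂ → ℂ → ℂ⟦X⟧}

theorem IsRowCoeff.sigma_ne_zero (hc : IsRowCoeff σ A B G N M) : σ ≠ 0 := by
  rintro rfl
  simpa using hc.sigma_sq

/-- The leading term of the ratio solves a quadratic equation, whose discriminant vanishes only at
`ξ = 0` and `ξ = 1`; in contrast to the spectral curve, nothing degenerates at `ξ = 1/2`. -/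
theorem IsRowSolution.quadratic (hc : IsRowCoeff σ A B G N M)
    (h : IsRowSolution T U σ A B G N M E w) {t ξ : ℂ} (ht : t ∈ T) (hξ : ξ ∈ U) :
    constantCoeff (w t ξ) ^ 2 + 2 * (2 * ξ - 1) * constantCoeff (w t ξ) + 1 = 0 := by
  obtain ⟨w', -, h1⟩ := h.riccati t ht ξ hξ
  have h2 := congrArg constantCoeff h1
  simp only [map_mul, map_add, map_sub, map_pow, constantCoeff_X, constantCoeff_C,
    constantCoeff_rescale, hc.A_zero, hc.B_zero, hc.G_zero, mul_zero, zero_mul] at h2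
  refine mul_left_cancel₀ hc.sigma_ne_zero ?_
  linear_combination 4 * h2

/-- One step of the uniqueness of formal solutions of the Riccati equation. -/
theorem riccati_unique_step {W W' P P' A B K : ℂ⟦X⟧} {κ : ℂ} {k : ℕ}
    (h0 : constantCoeff W = constantCoeff W')
    (hlin : constantCoeff K - 2 * constantCoeff A * constantCoeff W ≠ 0)
    (e : C κ * X * P = K * W + B - A * W ^ 2) (e' : C κ * X * P' = K * W' + B - A * W' ^ 2)
    (dW : X ^ k ∣ W - W') (dP : X ^ k ∣ P - P') : X ^ (k + 1) ∣ W - W' := by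
  obtain ⟨a, ha⟩ := dW
  obtain ⟨p, hp⟩ := dP
  have hX : (X ^ k : ℂ⟦X⟧) ≠ 0 := pow_ne_zero _ X_ne_zero
  have E1 : C κ * X * p = a * (K - A * (W + W')) := by
    refine mul_left_cancel₀ hX ?_
    linear_combination e - e' - C κ * X * hp + (K - A * (W + W')) * ha
  have C1 := congrArg constantCoeff E1
  simp only [map_mul, map_add, map_sub, constantCoeff_X, mul_zero, zero_mul, ← h0] at C1
  refine X_pow_succ_dvd_of_constantCoeff ha ((mul_eq_zero.1 C1.symm).resolve_right ?_)
  intro h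
  exact hlin (by linear_combination h)

/-- The ratio `w` is homogeneous: it is a power series in `ħ / t` with coefficients depending on
`ξ` only. -/
theorem IsRowSolution.exists_ratio (hT : IsOpen T) (hTc : IsConnected T) (hT0 : (0 : ℂ) ∉ T)
    (hU : IsOpen U) (hU0 : (0 : ℂ) ∉ U) (hU1 : (1 : ℂ) ∉ U)
    (hc : IsRowCoeff σ A B G N M) (h : IsRowSolution T U σ A B G N M E w) :
    ∃ W : ℂ → ℂ⟦X⟧, (∀ t ∈ T, ∀ ξ ∈ U, w t ξ = rescale t⁻¹ (W ξ)) ∧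
      (∀ ξ ∈ U, C (-(Real.pi : ℂ)) * X * (-(X * d⁄dX ℂ (W ξ))) =
        C σ * (G - C ξ) * W ξ + B - A * W ξ ^ 2) := by
  obtain ⟨t₀, ht₀⟩ := hTc.nonempty
  have hne : ∀ τ ∈ T, τ ≠ 0 := fun τ hτ h => hT0 (h ▸ hτ)
  suffices H : ∀ ξ ∈ U, (∀ t ∈ T, w t ξ = rescale t⁻¹ (rescale t₀ (w t₀ ξ))) ∧
      C (-(Real.pi : ℂ)) * X * (-(X * d⁄dX ℂ (rescale t₀ (w t₀ ξ)))) =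
        C σ * (G - C ξ) * rescale t₀ (w t₀ ξ) + B - A * rescale t₀ (w t₀ ξ) ^ 2 from
    ⟨fun ξ => rescale t₀ (w t₀ ξ), fun t ht ξ hξ => (H ξ hξ).1 t ht, fun ξ hξ => (H ξ hξ).2⟩
  intro ξ hξ
  have hξ0 : ξ ≠ 0 := fun h => hU0 (h ▸ hξ)
  have hξ1 : ξ - 1 ≠ 0 := fun h => hU1 (sub_eq_zero.1 h ▸ hξ)
  set r : ℂ → ℂ := fun t => constantCoeff (w t ξ) + (2 * ξ - 1) with hr
  have hr2 : ∀ t ∈ T, r t ^ 2 = 4 * (ξ * (ξ - 1)) := fun t ht => by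
    simp only [hr]; linear_combination h.quadratic hc ht hξ
  have hrne : ∀ t ∈ T, r t ≠ 0 := fun t ht h0 => by
    have h1 := hr2 t ht
    rw [h0] at h1
    exact mul_ne_zero (by norm_num : (4 : ℂ) ≠ 0) (mul_ne_zero hξ0 hξ1) (by rw [← h1]; ring)
  -- by connectedness of `T`, the same root of the quadratic equation is taken for all `t`
  have hw0 : ∀ t ∈ T, constantCoeff (w t ξ) = constantCoeff (w t₀ ξ) := by
    have hrc : ContinuousOn r T := fun t ht =>
      ((differentiableAt_slice_left (S := fun t ξ => constantCoeff (w t ξ)) hT hU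
        h.ratio_differentiableOn ht hξ).continuousAt.add
        continuousAt_const).continuousWithinAt
    rcases hTc.isPreconnected.eq_or_eq_neg_of_sq_eq (g := fun _ => r t₀) hrc continuousOn_const
      (fun t ht => (hr2 t ht).trans (hr2 t₀ ht₀).symm) (fun _ => hrne t₀ ht₀) with h1 | h1
    · intro t ht
      exact add_right_cancel (h1 ht)
    · have h2 : r t₀ = -r t₀ := h1 ht₀
      exact absurd (self_eq_neg.1 h2) (hrne t₀ ht₀)
  choose! w' hw' hric using fun t (ht : t ∈ T) => h.riccati t ht ξ hξ
  set Wh : ℂ → ℂ⟦X⟧ := fun t => C (t ^ (0 : ℤ)) * rescale t (w t ξ) with hWh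
  set P : ℂ → ℂ⟦X⟧ := fun t => C (t ^ (0 : ℤ) * t) * rescale t (w' t) with hPd
  have hWh' : ∀ t, Wh t = rescale t (w t ξ) := fun t => by simp [hWh]
  have e : ∀ t ∈ T, C (-(Real.pi : ℂ)) * X * P t =
      C σ * (G - C ξ) * Wh t + B - A * Wh t ^ 2 := fun t ht => by
    have h1 := congrArg (rescale t) (hric t ht)
    simp only [map_mul, map_add, map_sub, map_pow, rescale_C, rescale_X,
      rescale_rescale_inv (hne t ht), ← hWh'] at h1
    simp only [hPd, zpow_zero, one_mul]
    linear_combination h1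
  have hW0 : ∀ t ∈ T, constantCoeff (Wh t) = constantCoeff (Wh t₀) := fun t ht => by
    rw [hWh', hWh', constantCoeff_rescale, constantCoeff_rescale, hw0 t ht]
  have hlin : ∀ t ∈ T, constantCoeff (C σ * (G - C ξ)) -
      2 * constantCoeff A * constantCoeff (Wh t) ≠ 0 := fun t ht h0 => by
    rw [hWh', constantCoeff_rescale, map_mul, map_sub, constantCoeff_C, constantCoeff_C,
      hc.G_zero, hc.A_zero] at h0
    refine mul_ne_zero hc.sigma_ne_zero (hrne t ht) ?_
    simp only [hr]
    linear_combination -2 * h0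
  have hP : ∀ k : ℕ, (∀ t ∈ T, X ^ k ∣ Wh t - Wh t₀) → ∀ t ∈ T,
      X ^ k ∣ P t + X * d⁄dX ℂ (Wh t₀) := fun k hk t ht => by
    have := X_pow_dvd_euler hT hT0 hw' hk ht
    simpa [hPd] using this
  have key : ∀ k : ℕ, ∀ t ∈ T, X ^ k ∣ Wh t - Wh t₀ := by
    intro k
    induction k with
    | zero => intro t _; simp
    | succ k ih =>
      intro t ht
      refine riccati_unique_step (hW0 t ht) (hlin t ht) (e t ht) (e t₀ ht₀) (ih t ht) ?_
      exact add_sub_add_right_eq_sub (P t) _ _ ▸ dvd_sub (hP k ih t ht) (hP k ih t₀ ht₀)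
  have hWeq : ∀ t ∈ T, Wh t = Wh t₀ := fun t ht => eq_of_forall_X_pow_dvd fun k => key k t ht
  rw [← hWh']
  refine ⟨fun t ht => ?_, ?_⟩
  · rw [← hWeq t ht, hWh', rescale_inv_rescale (hne t ht)]
  · have hPt : P t₀ = -(X * d⁄dX ℂ (Wh t₀)) :=
      eq_of_forall_X_pow_dvd fun k => by
        simpa using hP k (key k) t₀ ht₀
    rw [← hPt]
    exact e t₀ ht₀

/-- All coefficients of the ratio continue analytically wherever the square root
`w₀ + 2 ξ - 1 = 2 √(ξ (ξ - 1))` and its inverse do: they are polynomials in these functions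
and `ξ`. -/
theorem seriesContinuesAlong_ratio (hU : IsOpen U) (hc : IsRowCoeff σ A B G N M)
    {W : ℂ → ℂ⟦X⟧}
    (hric : ∀ ξ ∈ U, C (-(Real.pi : ℂ)) * X * (-(X * d⁄dX ℂ (W ξ))) =
        C σ * (G - C ξ) * W ξ + B - A * W ξ ^ 2)
    {a b : ℂ} {γ : Path a b} (ha : a ∈ U)
    (hr0 : ∀ ξ ∈ U, constantCoeff (W ξ) + (2 * ξ - 1) ≠ 0)
    (h0 : ContinuesAlong (fun ξ => constantCoeff (W ξ)) γ)
    (hr : ContinuesAlong (fun ξ => (constantCoeff (W ξ) + (2 * ξ - 1))⁻¹) γ) :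
    SeriesContinuesAlong W γ := by
  intro n
  induction n using Nat.strong_induction_on with
  | _ n ih =>
    rcases Nat.eq_zero_or_pos n with rfl | hn
    · simpa using h0
    set P : ℂ → ℂ⟦X⟧ := fun ξ => (trunc n (W ξ) : Polynomial ℂ) with hPd
    have hP : SeriesContinuesAlong P γ := fun m => by
      by_cases hm : m < n
      · simpa [hPd, coeff_trunc, hm] using ih m hm
      · simpa [hPd, coeff_trunc, hm] using ContinuesAlong.const (γ := γ) 0
    have hσ : SeriesContinuesAlong (fun ξ => C σ * (G - C ξ)) γ :=
      (SeriesContinuesAlong.const _).mul ((SeriesContinuesAlong.const _).sub (.C .id))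
    have hR : SeriesContinuesAlong (fun ξ => C σ * (G - C ξ) * P ξ + B - A * (P ξ * P ξ)) γ :=
      ((hσ.mul hP).add (.const _)).sub ((SeriesContinuesAlong.const _).mul (hP.mul hP))
    -- the coefficient of `ħ^n` of the equation, solved for the `n`-th coefficient
    have hform : ∀ ξ ∈ U, coeff n (W ξ) = 2 * σ * (constantCoeff (W ξ) + (2 * ξ - 1))⁻¹ *
        (coeff n (C σ * (G - C ξ) * P ξ + B - A * (P ξ * P ξ)) -
          (Real.pi : ℂ) * ((n : ℂ) - 1) * coeff (n - 1) (W ξ)) := by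
      intro ξ hξ
      obtain ⟨k, rfl⟩ : ∃ k, n = k + 1 := ⟨n - 1, by omega⟩
      set V : ℂ⟦X⟧ := mk fun i => coeff (i + (k + 1)) (W ξ) with hV
      have hsplit : W ξ = X ^ (k + 1) * V + P ξ := eq_X_pow_mul_shift_add_trunc (k + 1) (W ξ)
      have hV0 : constantCoeff V = coeff (k + 1) (W ξ) := by
        rw [hV, ← coeff_zero_eq_constantCoeff, coeff_mk, zero_add]
      have hP0 : constantCoeff (P ξ) = constantCoeff (W ξ) := by
        have := congrArg constantCoeff hsplit
        rw [map_add, map_mul, map_pow, constantCoeff_X] at this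
        simpa using this.symm
      have hexp : C σ * (G - C ξ) * W ξ + B - A * W ξ ^ 2 =
          (C σ * (G - C ξ) * P ξ + B - A * (P ξ * P ξ)) +
          X ^ (k + 1) * ((C σ * (G - C ξ) - A * (P ξ + P ξ) - A * (X ^ (k + 1) * V)) * V) := by
        rw [hsplit]; ring
      have h1 := congrArg (coeff (k + 1)) (hric ξ hξ)
      have hl : coeff (k + 1) (C (-(Real.pi : ℂ)) * X * (-(X * d⁄dX ℂ (W ξ)))) =
          Real.pi * k * coeff k (W ξ) := by
        rw [mul_assoc, coeff_C_mul, coeff_succ_X_mul, map_neg]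
        cases k with
        | zero => simp
        | succ k => rw [coeff_succ_X_mul, coeff_derivative]; push_cast; ring
      have hq : coeff (k + 1) (X ^ (k + 1) *
          ((C σ * (G - C ξ) - A * (P ξ + P ξ) - A * (X ^ (k + 1) * V)) * V)) =
          -(σ / 2) * (constantCoeff (W ξ) + (2 * ξ - 1)) * coeff (k + 1) (W ξ) := by
        have := coeff_X_pow_mul ((C σ * (G - C ξ) - A * (P ξ + P ξ) - A * (X ^ (k + 1) * V)) * V)
          (k + 1) 0
        rw [zero_add] at this
        rw [this, coeff_zero_eq_constantCoeff]
        simp only [map_mul, map_add, map_sub, map_pow, constantCoeff_X, constantCoeff_C,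
          hc.A_zero, hc.G_zero, hP0, hV0]
        rw [zero_pow (Nat.succ_ne_zero k)]
        ring
      rw [hexp, map_add, hl, hq] at h1
      have hr' := hr0 ξ hξ
      rw [Nat.add_sub_cancel]
      push_cast
      rw [mul_assoc (2 * σ), mul_comm, mul_assoc, eq_comm, inv_mul_eq_iff_eq_mul₀ hr']
      linear_combination (-2 * σ) * h1 + (constantCoeff (W ξ) + (2 * ξ - 1)) *
        coeff (k + 1) (W ξ) * hc.sigma_sq
    refine ContinuesAlong.congr ?_ (Filter.eventuallyEq_of_mem (hU.mem_nhds ha)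
      fun ξ hξ => (hform ξ hξ).symm)
    exact (hr.const_mul (2 * σ)).mul ((hR n).sub ((ih (n - 1) (by omega)).const_mul _))

end PainleveFive

/-! ### Coefficients of the exponent -/

namespace PainleveFive

open PowerSeries

variable {T U : Set ℂ} {σ : ℂ} {A B G : ℂ⟦X⟧} {N M : ℂ → ℂ⟦X⟧} {E : ℕ → ℂ → ℂ → ℂ}
  {w : ℂ → ℂ → ℂ⟦X⟧}

/-- The second coefficient of the ratio is a multiple of the first one. -/
theorem coeff_one_ratio (hc : IsRowCoeff σ A B G N M) {W : ℂ⟦X⟧} {ξ : ℂ}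
    (hric : C (-(Real.pi : ℂ)) * X * (-(X * d⁄dX ℂ W)) = C σ * (G - C ξ) * W + B - A * W ^ 2)
    (hq : constantCoeff W ^ 2 + 2 * (2 * ξ - 1) * constantCoeff W + 1 = 0)
    (hr : constantCoeff W + (2 * ξ - 1) ≠ 0) :
    coeff 1 W = 2 * Real.pi * σ * constantCoeff W := by
  have h1 := congrArg (coeff 1) hric
  have hC1 : ∀ c : ℂ, coeff 1 (C c : ℂ⟦X⟧) = 0 := fun c => by simp
  simp only [mul_assoc, sq, coeff_C_mul, map_sub, map_add, coeff_one_mul, map_mul, map_neg,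
    constantCoeff_X, constantCoeff_C, hc.A_zero, hc.A_one, hc.B_one, hc.G_zero, hc.G_one,
    coeff_one_X, hC1, mul_zero, zero_mul] at h1
  refine mul_left_cancel₀ hr ?_
  linear_combination 2 * σ * h1 - (coeff 1 W * (2 * ξ - 1) + coeff 1 W * constantCoeff W) *
    hc.sigma_sq - σ * Real.pi * hq

/-- Scaled formulas for the derivatives of an exponent, coefficient by coefficient. -/
theorem IsRowSolution.deriv_formulas (h : IsRowSolution T U σ A B G N M E w) {W : ℂ → ℂ⟦X⟧}
    (hW : ∀ t ∈ T, ∀ ξ ∈ U, w t ξ = rescale t⁻¹ (W ξ)) (j : ℕ) {t ξ : ℂ} (ht : t ∈ T)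
    (hξ : ξ ∈ U) :
    deriv (fun τ => E j τ ξ) t =
        -(1 / (Real.pi : ℂ)) * coeff j (C (σ * ξ / 2) + A * W ξ) * t⁻¹ ^ j ∧
      deriv (fun x => E j t x) ξ =
        -(1 / (Real.pi : ℂ)) * coeff j (N ξ + M ξ * W ξ) * (t * t⁻¹ ^ j) := by
  have hpi : (Real.pi : ℂ) ≠ 0 := by exact_mod_cast Real.pi_ne_zero
  have h1 := congrArg (coeff j) (h.eq_t t ht ξ hξ)
  have h2 := congrArg (coeff j) (h.eq_xi t ht ξ hξ)
  rw [hW t ht ξ hξ, ← rescale_C t⁻¹ (σ * ξ / 2), ← map_mul, ← map_add, coeff_rescale, coeff_C_mul,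
    coeff_mk] at h1
  rw [hW t ht ξ hξ, ← map_mul, ← map_add, coeff_C_mul, coeff_C_mul, coeff_rescale,
    coeff_mk] at h2
  constructor
  · field_simp
    linear_combination -h1
  · field_simp
    linear_combination -h2

/-- A function continues analytically along `γ` if its exponential does so without zeros. -/
theorem ContinuesAlong.of_exp {a b : ℂ} {γ : Path a b} {Γ : unitInterval → ℂ → ℂ}
    (hΓ : IsGermFamily γ Γ) (h0 : ∀ s, Γ s (γ s) ≠ 0) {f : ℂ → ℂ} (hf : AnalyticAt ℂ f a)
    (hfΓ : ∀ᶠ x in 𝓝 a, Complex.exp (f x) = Γ 0 x) : ContinuesAlong f γ := by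
  obtain ⟨F, h1, h2, -⟩ := hΓ.exists_log h0 hf hfΓ
  exact continuesAlong_iff.2 ⟨F, h1, h2⟩

/-- The coefficient of `ħ⁰` of the exponent is `-½ log (ω (ω + 2ξ - 1))` up to a constant, where
`ω` is the leading term of the ratio. -/
theorem exists_exp_coeff_one {S ω : ℂ → ℂ} (hU : IsOpen U) (hUc : IsConnected U)
    (hS : DifferentiableOn ℂ S U) (hω : DifferentiableOn ℂ ω U)
    (hq : ∀ ξ ∈ U, ω ξ ^ 2 + 2 * (2 * ξ - 1) * ω ξ + 1 = 0)
    (hr : ∀ ξ ∈ U, ω ξ + (2 * ξ - 1) ≠ 0)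
    (hS' : ∀ ξ ∈ U, deriv S ξ = ω ξ / (ω ξ + (2 * ξ - 1)) ^ 2) :
    ∃ K : ℂ, K ≠ 0 ∧
      ∀ ξ ∈ U, Complex.exp (-2 * S ξ) = K * (ω ξ * (ω ξ + (2 * ξ - 1))) := by
  have hω0 : ∀ ξ ∈ U, ω ξ ≠ 0 := fun ξ hξ h => by
    have := hq ξ hξ
    rw [h] at this
    simp at this
  have hd : ∀ ξ ∈ U, HasDerivAt
      (fun x => Complex.exp (2 * S x) * (ω x * (ω x + (2 * x - 1)))) 0 ξ := by
    intro ξ hξ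
    have h1 := (hS.differentiableAt (hU.mem_nhds hξ)).hasDerivAt
    have h2 := (hω.differentiableAt (hU.mem_nhds hξ)).hasDerivAt
    have h3 : HasDerivAt (fun x : ℂ => 2 * x - 1) (2 * 1) ξ :=
      ((hasDerivAt_id' ξ).const_mul 2).sub_const 1
    -- the derivative of the quadratic equation
    have h4 : HasDerivAt (fun x => ω x * ω x + 2 * ((2 * x - 1) * ω x) + 1)
        (deriv ω ξ * ω ξ + ω ξ * deriv ω ξ +
          2 * (2 * 1 * ω ξ + (2 * ξ - 1) * deriv ω ξ)) ξ :=
      ((h2.fun_mul h2).fun_add ((h3.fun_mul h2).const_mul 2)).add_const 1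
    have h5 : HasDerivAt (fun x => ω x * ω x + 2 * ((2 * x - 1) * ω x) + 1) 0 ξ :=
      (hasDerivAt_const ξ (0 : ℂ)).congr_of_eventuallyEq <| by
        filter_upwards [hU.mem_nhds hξ] with x hx
        linear_combination hq x hx
    have h6 := h4.unique h5
    refine (((h1.const_mul 2).cexp).fun_mul (h2.fun_mul (h2.fun_add h3))).congr_deriv ?_
    rw [hS' ξ hξ]
    have hr' := hr ξ hξ
    have h7 : deriv ω ξ = -2 * ω ξ / (ω ξ + (2 * ξ - 1)) := by
      rw [eq_div_iff hr']
      linear_combination (1 / 2) * h6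
    rw [h7]
    field_simp
    ring
  obtain ⟨c, hc⟩ := hU.exists_is_const_of_deriv_eq_zero hUc.isPreconnected
    (fun t ht => (hd t ht).differentiableAt.differentiableWithinAt) (fun t ht => (hd t ht).deriv)
  obtain ⟨ξ₀, hξ₀⟩ := hUc.nonempty
  have hc0 : c ≠ 0 := by
    rw [← hc ξ₀ hξ₀]
    exact mul_ne_zero (Complex.exp_ne_zero _) (mul_ne_zero (hω0 _ hξ₀) (hr _ hξ₀))
  refine ⟨c⁻¹, inv_ne_zero hc0, fun ξ hξ => ?_⟩
  rw [eq_inv_mul_iff_mul_eq₀ hc0, ← hc ξ hξ, mul_right_comm, ← Complex.exp_add]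
  ring_nf
  simp

/-- The `t`-dependence, the leading term, and the singularities of the exponent of one entry of
the wave matrix. -/
theorem IsRowSolution.separated (hT : IsOpen T) (hTc : IsConnected T) (hT0 : (0 : ℂ) ∉ T)
    (hU : IsOpen U) (hUc : IsConnected U) (hU0 : (0 : ℂ) ∉ U) (hU1 : (1 : ℂ) ∉ U)
    (hc : IsRowCoeff σ A B G N M) (h : IsRowSolution T U σ A B G N M E w) :
    (∀ t ∈ T, ∀ ξ ∈ U, deriv (fun x => E 0 t x) ξ ^ 2 =
      t ^ 2 * (2 * ξ - 1) ^ 2 / (16 * (Real.pi : ℂ) ^ 2 * (ξ * (ξ - 1)))) ∧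
    ∃ (s : ℕ → ℂ → ℂ) (c : ℕ → ℂ),
      (∀ j, ∀ t ∈ T, ∀ ξ ∈ U, E j t ξ = s j ξ / t ^ ((j : ℤ) - 1) + c j) ∧
      ∀ j, SingularOnlyAt {0, 1} (s j) U := by
  obtain ⟨W, hW, hric⟩ := h.exists_ratio hT hTc hT0 hU hU0 hU1 hc
  obtain ⟨t₀, ht₀⟩ := hTc.nonempty
  have hne : ∀ τ ∈ T, τ ≠ 0 := fun τ hτ h => hT0 (h ▸ hτ)
  have hpi : (Real.pi : ℂ) ≠ 0 := by exact_mod_cast Real.pi_ne_zero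
  have hξ0 : ∀ ξ ∈ U, ξ ≠ 0 := fun ξ hξ h => hU0 (h ▸ hξ)
  have hξ1' : ∀ ξ ∈ U, ξ ≠ 1 := fun ξ hξ h => hU1 (h ▸ hξ)
  have hξ1 : ∀ ξ ∈ U, ξ - 1 ≠ 0 := fun ξ hξ => sub_ne_zero.2 (hξ1' ξ hξ)
  set ω : ℂ → ℂ := fun ξ => constantCoeff (W ξ)
  have hω : ∀ t ∈ T, ∀ ξ ∈ U, constantCoeff (w t ξ) = ω ξ := fun t ht ξ hξ => by
    rw [hW t ht ξ hξ, constantCoeff_rescale]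
  have hq : ∀ ξ ∈ U, ω ξ ^ 2 + 2 * (2 * ξ - 1) * ω ξ + 1 = 0 := fun ξ hξ => by
    rw [← hω t₀ ht₀ ξ hξ]; exact h.quadratic hc ht₀ hξ
  have hr2 : ∀ ξ ∈ U, (ω ξ + (2 * ξ - 1)) ^ 2 = 4 * (ξ * (ξ - 1)) := fun ξ hξ => by
    linear_combination hq ξ hξ
  have hr0 : ∀ ξ ∈ U, ω ξ + (2 * ξ - 1) ≠ 0 := fun ξ hξ h0 => by
    have h1 := hr2 ξ hξ
    rw [h0] at h1
    exact mul_ne_zero (by norm_num : (4 : ℂ) ≠ 0) (mul_ne_zero (hξ0 ξ hξ) (hξ1 ξ hξ))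
      (by rw [← h1]; ring)
  have hωd : DifferentiableOn ℂ ω U := fun ξ hξ => by
    have h1 := differentiableAt_slice_right (S := fun t ξ => constantCoeff (w t ξ)) hT hU
      h.ratio_differentiableOn ht₀ hξ
    exact h1.differentiableWithinAt.congr (fun x hx => (hω t₀ ht₀ x hx).symm)
      (hω t₀ ht₀ ξ hξ).symm
  have hW1 : ∀ ξ ∈ U, coeff 1 (W ξ) = 2 * Real.pi * σ * ω ξ := fun ξ hξ =>
    coeff_one_ratio hc (hric ξ hξ) (hq ξ hξ) (hr0 ξ hξ)
  have hσ := hc.sigma_sq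
  -- the exponent has no logarithmic term in `t`
  have hF1 : ∀ ξ ∈ U, coeff 1 (C (σ * ξ / 2) + A * W ξ) = 0 := fun ξ hξ => by
    rw [map_add, coeff_one_mul, hc.A_zero, hc.A_one, hW1 ξ hξ]
    simp only [coeff_C, one_ne_zero, if_false]
    change 0 + (-(Real.pi : ℂ) / 2 * ω ξ + _) = 0
    linear_combination (Real.pi / 2 * ω ξ) * hσ
  have hS1 : ∀ t ∈ T, ∀ ξ ∈ U,
      deriv (fun x => E 1 t x) ξ = ω ξ / (ω ξ + (2 * ξ - 1)) ^ 2 := fun t ht ξ hξ => by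
    have hx0 := hξ0 ξ hξ
    have hx1 := hξ1 ξ hξ
    have ht' := hne t ht
    rw [(h.deriv_formulas hW 1 ht hξ).2, map_add, coeff_one_mul, hW1 ξ hξ, hc.N_one,
      hc.M_zero ξ hx0 (hξ1' ξ hξ), hc.M_one ξ hx0 (hξ1' ξ hξ), hr2 ξ hξ]
    change -(1 / (Real.pi : ℂ)) * (0 + (-(Real.pi : ℂ) / (2 * (ξ - 1)) * ω ξ + _)) * _ = _
    field_simp
    linear_combination (-16 * Real.pi * ω ξ * (2 * ξ - 1)) * hσ
  refine ⟨fun t ht ξ hξ => ?_, ?_⟩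
  · have hx0 := hξ0 ξ hξ
    have hx1 := hξ1 ξ hξ
    rw [(h.deriv_formulas hW 0 ht hξ).2, coeff_zero_eq_constantCoeff, map_add, map_mul,
      hc.N_zero ξ hx0 (hξ1' ξ hξ), hc.M_zero ξ hx0 (hξ1' ξ hξ)]
    change (-(1 / (Real.pi : ℂ)) * (_ + _ * ω ξ) * _) ^ 2 = _
    have hfac : σ * (2 * ξ - 1) ^ 2 / (8 * (ξ * (ξ - 1))) +
        σ * (2 * ξ - 1) / (8 * (ξ * (ξ - 1))) * ω ξ =
        σ * (2 * ξ - 1) * (ω ξ + (2 * ξ - 1)) / (8 * (ξ * (ξ - 1))) := by ring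
    rw [hfac, pow_zero, mul_one, mul_pow, mul_pow, div_pow, mul_pow, mul_pow, hr2 ξ hξ, hσ]
    field_simp
    ring
  -- the functions of `ξ`
  set s : ℕ → ℂ → ℂ := fun j => if j = 1 then fun ξ => E 1 t₀ ξ else
    fun ξ => -(1 / (Real.pi : ℂ)) / (1 - j) * coeff j (C (σ * ξ / 2) + A * W ξ) with hs
  have hex : ∀ j, ∃ c : ℂ, ∀ t ∈ T, ∀ ξ ∈ U, E j t ξ = s j ξ / t ^ ((j : ℤ) - 1) + c := by
    intro j
    rcases eq_or_ne j 1 with rfl | hj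
    · refine ⟨0, fun t ht ξ hξ => ?_⟩
      have hd : ∀ t ∈ T, HasDerivAt (fun τ => E 1 τ ξ) 0 t := fun t ht => by
        refine (differentiableAt_slice_left hT hU
          (h.differentiableOn 1) ht hξ).hasDerivAt.congr_deriv ?_
        rw [(h.deriv_formulas hW 1 ht hξ).1, hF1 ξ hξ]; ring
      have := hT.is_const_of_deriv_eq_zero hTc.isPreconnected
        (fun t ht => (hd t ht).differentiableAt.differentiableWithinAt)
        (fun t ht => (hd t ht).deriv) ht ht₀
      simpa [hs] using this
    · have hj' : (1 - (j : ℂ)) ≠ 0 := by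
        rw [sub_ne_zero]; exact_mod_cast hj.symm
      have hpow : ∀ t ∈ T, t⁻¹ ^ j = t ^ ((1 - (j : ℤ)) - 1) := fun t ht => by
        rw [show (1 - (j : ℤ)) - 1 = -(j : ℤ) by ring, zpow_neg, zpow_natCast, inv_pow]
      obtain ⟨c, hcc⟩ := exists_eq_mul_zpow_add hT hTc hT0 hU hUc (h.differentiableOn j)
        (m := 1 - (j : ℤ)) (by omega) (s := s j)
        (h := fun ξ => -(1 / (Real.pi : ℂ)) * coeff j (N ξ + M ξ * W ξ))
        (fun t ht ξ hξ => by
          rw [(h.deriv_formulas hW j ht hξ).1, hpow t ht]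
          simp only [hs, hj, if_false]
          push_cast
          field_simp)
        (fun t ht ξ hξ => by
          rw [(h.deriv_formulas hW j ht hξ).2, hpow t ht, zpow_sub_one₀ (hne t ht)]
          have := hne t ht
          field_simp)
      refine ⟨c, fun t ht ξ hξ => ?_⟩
      rw [hcc t ht ξ hξ, div_eq_mul_inv, ← zpow_neg, neg_sub]
  choose c hcs using hex
  refine ⟨s, c, hcs, fun j a ha b γ hγ => ?_⟩
  have hUa := hU.mem_nhds ha
  have hωa : AnalyticAt ℂ ω a := hωd.analyticAt hUa
  have hlin : AnalyticAt ℂ (fun x : ℂ => 2 * x - 1) a := by fun_prop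
  obtain ⟨R, hR0, hR, hRsq, hRne, hRinv⟩ := exists_sqrt_germFamily hγ
    (r := fun x => ω x + (2 * x - 1)) (hωa.add hlin)
    (Filter.eventually_of_mem hUa fun x hx => hr2 x hx)
  have hlinF : IsGermFamily γ fun _ x => -(2 * x - 1) := .of_analytic fun x => by fun_prop
  have hωF := hR.add hlinF
  have hω0 : (fun x => R 0 x + -(2 * x - 1)) =ᶠ[𝓝 a] ω := by
    filter_upwards [hR0] with x hx
    rw [hx]; ring
  rcases eq_or_ne j 1 with rfl | hj
  · have hSd : DifferentiableOn ℂ (fun x => E 1 t₀ x) U := fun ξ hξ =>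
      (differentiableAt_slice_right hT hU (h.differentiableOn 1) ht₀ hξ).differentiableWithinAt
    obtain ⟨K, hK, hexp⟩ := exists_exp_coeff_one hU hUc hSd hωd hq hr0 (hS1 t₀ ht₀)
    have hΓ : IsGermFamily γ fun s x => K * ((R s x + -(2 * x - 1)) * R s x) :=
      (IsGermFamily.of_analytic fun _ => analyticAt_const).mul (hωF.mul hR)
    have hlog := ContinuesAlong.of_exp hΓ (fun s => ?_) (f := fun x => -2 * E 1 t₀ x)
      (analyticAt_const.mul (hSd.analyticAt hUa)) ?_
    · have := hlog.const_mul (-1 / 2)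
      simp only [hs, if_true]
      convert this using 2 with x
      ring
    · refine mul_ne_zero hK (mul_ne_zero (fun h0 => ?_) (hRne s))
      have h1 := hRsq s
      have h2 : R s (γ s) = 2 * γ s - 1 := by linear_combination h0
      rw [h2] at h1
      have h3 : (1 : ℂ) = 0 := by linear_combination h1
      exact one_ne_zero h3
    · filter_upwards [hR0, hω0, hUa] with x h1 h2 hx
      rw [h2, h1]; exact hexp x hx
  · have hWc := seriesContinuesAlong_ratio hU hc hric ha hr0
      (continuesAlong_iff.2 ⟨_, hω0, hωF⟩) hRinv
    have hlinc : ContinuesAlong (fun x => σ * x / 2) γ := .of_analytic fun x => by fun_prop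
    have hfin := ((SeriesContinuesAlong.C hlinc).add
      ((SeriesContinuesAlong.const A).mul hWc)) j
    simp only [hs, hj, if_false]
    exact hfin.const_mul _

end PainleveFive

/-! ### From the Lax pair to the two rows -/

namespace PainleveFive

open PowerSeries

/-- The scaled coefficients of the first row (`σ = 1`) and of the second row (`σ = -1`). The two
rows differ by the sign `σ` and by the exchange of the off-diagonal entries of `𝓡`. -/
theorem isRowCoeff_of_painleve {Y Z : ℂ⟦X⟧} (hY0 : constantCoeff Y = -1)
    (hZ0 : constantCoeff Z = -1 / 8) (hY1 : coeff 1 Y = 4 * Real.pi) (hZ1 : coeff 1 Z = 0) :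
    IsRowCoeff 1 (-Z + Y * Z) (Z - Z * Y⁻¹) (-2 * Z + Y * Z + Z * Y⁻¹)
        (fun ξ => C (1 / 2) + C (1 / ξ) * Z - C (1 / (ξ - 1)) * Z)
        (fun ξ => -C (1 / ξ) * Z + C (1 / (ξ - 1)) * Y * Z) ∧
      IsRowCoeff (-1) (Z - Z * Y⁻¹) (-Z + Y * Z) (-2 * Z + Y * Z + Z * Y⁻¹)
        (fun ξ => -(C (1 / 2) + C (1 / ξ) * Z - C (1 / (ξ - 1)) * Z))
        (fun ξ => C (1 / ξ) * Z - C (1 / (ξ - 1)) * Z * Y⁻¹) := by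
  have hYne : constantCoeff Y ≠ 0 := by rw [hY0]; norm_num
  have hI : Y⁻¹ * Y = 1 := PowerSeries.inv_mul_cancel _ hYne
  have hI0 : constantCoeff Y⁻¹ = -1 := by
    have := congrArg constantCoeff hI
    rw [map_mul, hY0, map_one] at this
    linear_combination -this
  have hC1 : ∀ c : ℂ, coeff 1 (C c : ℂ⟦X⟧) = 0 := fun c => by simp
  have hI1 : coeff 1 Y⁻¹ = -4 * Real.pi := by
    have := congrArg (coeff 1) hI
    rw [coeff_one_mul, hY0, hI0, hY1, ← map_one (C (R := ℂ)), hC1] at this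
    linear_combination -this
  have h2 : (-2 : ℂ⟦X⟧) = C (-2) := by rw [map_neg, map_ofNat]
  constructor <;> constructor
  all_goals try intro ξ
  all_goals try intro h0
  all_goals try intro h1
  all_goals try rw [h2]
  all_goals try simp only [map_add, map_sub, map_neg, map_mul, coeff_one_mul, hY0, hZ0, hY1, hZ1,
    hI0, hI1, hC1, constantCoeff_C, zero_mul]
  all_goals try have h1' := sub_ne_zero.2 h1
  all_goals try field_simp
  all_goals ring

/-- Eliminating the other entry `exp (F / ħ)` of the column gives the equations of a row. Here
`Λ = ± log u` and the ratio is `exp ((Λ + F - E) / ħ)`. -/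
theorem isRowSolution_of_lax {T U : Set ℂ} (hT : IsOpen T) (hU : IsOpen U) {σ : ℂ}
    {A B G : ℂ⟦X⟧} {N M : ℂ → ℂ⟦X⟧} {E F : ℕ → ℂ → ℂ → ℂ} {Λ Λ' : ℂ → ℂ⟦X⟧}
    (hE : ∀ j, DifferentiableOn ℂ (fun p : ℂ × ℂ => E j p.1 p.2) (T ×ˢ U))
    (hF : ∀ j, DifferentiableOn ℂ (fun p : ℂ × ℂ => F j p.1 p.2) (T ×ˢ U))
    (hΛ : ∀ t ∈ T, HasSeriesDerivAt Λ (Λ' t) t)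
    (hΛ' : ∀ t ∈ T, C (-(Real.pi : ℂ)) * Λ' t = C σ * rescale t⁻¹ G)
    (h0 : ∀ t ∈ T, ∀ ξ ∈ U, coeff 0 (Λ t) + F 0 t ξ = E 0 t ξ)
    (hEt : ∀ t ∈ T, ∀ ξ ∈ U, C (-(Real.pi : ℂ)) * mk (fun j => deriv (fun τ => E j τ ξ) t) =
      C (σ * ξ / 2) + rescale t⁻¹ A *
        expFactor (Λ t + mk (fun j => F j t ξ) - mk (fun j => E j t ξ)))
    (hFt : ∀ t ∈ T, ∀ ξ ∈ U, C (-(Real.pi : ℂ)) * mk (fun j => deriv (fun τ => F j τ ξ) t) =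
      C (-σ * ξ / 2) + rescale t⁻¹ B *
        expFactor (-Λ t + mk (fun j => E j t ξ) - mk (fun j => F j t ξ)))
    (hEξ : ∀ t ∈ T, ∀ ξ ∈ U, C (-(Real.pi : ℂ)) * mk (fun j => deriv (fun x => E j t x) ξ) =
      C t * (rescale t⁻¹ (N ξ) + rescale t⁻¹ (M ξ) *
        expFactor (Λ t + mk (fun j => F j t ξ) - mk (fun j => E j t ξ)))) :
    IsRowSolution T U σ A B G N M E fun t ξ =>
      expFactor (Λ t + mk (fun j => F j t ξ) - mk (fun j => E j t ξ)) where
  differentiableOn := hE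
  eq_t := hEt
  eq_xi := hEξ
  riccati t ht ξ hξ := by
    have hd : ∀ {S : ℕ → ℂ → ℂ → ℂ},
        (∀ j, DifferentiableOn ℂ (fun p : ℂ × ℂ => S j p.1 p.2) (T ×ˢ U)) →
        HasSeriesDerivAt (fun τ => mk fun j => S j τ ξ)
          (mk fun j => deriv (fun τ => S j τ ξ) t) t := fun hS n => by
      simpa using (differentiableAt_slice_left hT hU (hS n) ht hξ).hasDerivAt
    have he := ((hΛ t ht).add (hd hF)).sub (hd hE)
    set e' : ℂ⟦X⟧ := Λ' t + (mk fun j => deriv (fun τ => F j τ ξ) t) -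
      mk fun j => deriv (fun τ => E j τ ξ) t with he'
    refine ⟨_, he.expFactor, ?_⟩
    -- the leading exponents cancel identically, so that `ħ` divides the derivative of the exponent
    have he0 : coeff 0 e' = 0 := by
      refine (he 0).unique ((hasDerivAt_const t (0 : ℂ)).congr_of_eventuallyEq ?_)
      filter_upwards [hT.mem_nhds ht] with τ hτ
      have := h0 τ hτ ξ hξ
      rw [map_sub, map_add, coeff_mk, coeff_mk, this, sub_self]
    have hX : X * (mk fun k => coeff (k + 1) e') = e' := by
      ext n
      cases n with
      | zero => rw [he0]; simp
      | succ n => rw [coeff_succ_X_mul, coeff_mk]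
    have hinv := expFactor_mul_neg (Λ t + mk (fun j => F j t ξ) - mk (fun j => E j t ξ))
    have hneg : -(Λ t + mk (fun j => F j t ξ) - mk (fun j => E j t ξ)) =
        -Λ t + mk (fun j => E j t ξ) - mk (fun j => F j t ξ) := by ring
    rw [hneg] at hinv
    have h1 := hEt t ht ξ hξ
    have h2 := hFt t ht ξ hξ
    set w := expFactor (Λ t + mk (fun j => F j t ξ) - mk (fun j => E j t ξ))
    set v := expFactor (-Λ t + mk (fun j => E j t ξ) - mk (fun j => F j t ξ))
    have h3 : C (-(Real.pi : ℂ)) * e' = C σ * rescale t⁻¹ G - C σ * C ξ + rescale t⁻¹ B * v -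
        rescale t⁻¹ A * w := by
      have h4 : (C (-σ * ξ / 2) - C (σ * ξ / 2) : ℂ⟦X⟧) = -(C σ * C ξ) := by
        rw [← map_sub, ← map_mul, ← map_neg]; congr 1; ring
      rw [he']
      linear_combination hΛ' t ht + h2 - h1 + h4
    linear_combination C (-(Real.pi : ℂ)) * w * hX + w * h3 + rescale t⁻¹ B * hinv
  ratio_ne_zero t _ ξ _ := by
    rw [constantCoeff_expFactor]; exact Complex.exp_ne_zero _
  ratio_differentiableOn := by
    simp only [constantCoeff_expFactor, map_sub, map_add, coeff_mk]
    have hΛd : DifferentiableOn ℂ (fun p : ℂ × ℂ => coeff 1 (Λ p.1)) (T ×ˢ U) := fun p hp =>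
      (DifferentiableAt.comp p (hΛ p.1 hp.1 1).differentiableAt
        differentiableAt_fst).differentiableWithinAt
    exact ((hΛd.add (hF 1)).sub (hE 1)).cexp

/-- The determinant defining the spectral curve has no exponential factors, and its limit is
computed from the leading terms `y₀ = -1`, `z₀ = -t/8`. -/
theorem onSpectralCurve_iff {y z L : ℕ → ℂ → ℂ} {Y Z : ℂ⟦X⟧} {t ξ : ℂ}
    (hY0 : constantCoeff Y = -1) (hZ0 : constantCoeff Z = -1 / 8)
    (hy : ser y t = rescale t⁻¹ Y) (hz : ser z t = C t * rescale t⁻¹ Z)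
    (h0 : ξ ≠ 0) (h1 : ξ ≠ 1) (η : ℂ) :
    OnSpectralCurve y z L t ξ η ↔
      η ^ 2 = t ^ 2 * (2 * ξ - 1) ^ 2 / (16 * (Real.pi : ℂ) ^ 2 * (ξ * (ξ - 1))) := by
  have hpi : (Real.pi : ℂ) ≠ 0 := by exact_mod_cast Real.pi_ne_zero
  have h1' : ξ - 1 ≠ 0 := sub_ne_zero.2 h1
  have hu : uFun L t * uInv L t = 1 := by
    rw [uFun, uInv, ← formalExp_add, add_neg_cancel, formalExp_zero]
  have hy0 : constantCoeff (ser y t) = -1 := by rw [hy, constantCoeff_rescale, hY0]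
  have hz0 : constantCoeff (ser z t) = -t / 8 := by
    rw [hz, map_mul, constantCoeff_C, constantCoeff_rescale, hZ0]; ring
  have hyi0 : constantCoeff (ser y t)⁻¹ = -1 := by
    rw [PowerSeries.constantCoeff_inv, hy0]; norm_num
  set p : ℂ⟦X⟧ := C (t / 2) + C (1 / ξ) * ser z t - C (1 / (ξ - 1)) * ser z t with hp
  set q : ℂ⟦X⟧ := -C (1 / ξ) * ser z t + C (1 / (ξ - 1)) * ser y t * ser z t with hq
  set r : ℂ⟦X⟧ := C (1 / ξ) * ser z t - C (1 / (ξ - 1)) * ser z t * (ser y t)⁻¹ with hr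
  set m : ℂ⟦X⟧ := C (-1 / (Real.pi : ℂ)) with hm
  have hp' : -C (t / 2) - C (1 / ξ) * ser z t + C (1 / (ξ - 1)) * ser z t = -p := by
    rw [hp]; ring
  have hdet : Matrix.det ((C η : ℂ⟦X⟧) • (1 : Matrix (Fin 2) (Fin 2) WKBRing)
      - m • laxD y z L t ξ) = (C η ^ 2 - m ^ 2 * (p ^ 2 + q * r)) • (1 : WKBRing) := by
    rw [Matrix.det_fin_two]
    simp only [laxD, ← hp, ← hq, ← hr, hp', Matrix.sub_apply, Matrix.smul_apply, Matrix.of_apply,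
      Matrix.cons_val', Matrix.cons_val_zero, Matrix.cons_val_one, Matrix.cons_val_fin_one,
      Matrix.one_apply_eq, ne_eq, zero_ne_one, one_ne_zero, not_false_eq_true,
      Matrix.one_apply_ne]
    simp only [Algebra.smul_def, map_neg, map_mul, map_sub, map_add, map_pow, mul_one, mul_zero]
    linear_combination (-(algebraMap ℂ⟦X⟧ WKBRing m) ^ 2 * algebraMap ℂ⟦X⟧ WKBRing q *
      algebraMap ℂ⟦X⟧ WKBRing r) * hu
  have hlim : ∀ f : ℂ⟦X⟧, HasHbarLimit (f • (1 : WKBRing)) 0 ↔ constantCoeff f = 0 := by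
    intro f
    refine ⟨fun ⟨g, hg, hg0⟩ => ?_, fun h => ⟨f, rfl, h⟩⟩
    have hone : (1 : WKBRing) = AddMonoidAlgebra.single 0 1 := rfl
    rw [hone, AddMonoidAlgebra.smul_single, AddMonoidAlgebra.smul_single, smul_eq_mul,
      smul_eq_mul, mul_one, mul_one] at hg
    have := congrArg (fun a : WKBRing => AddMonoidAlgebra.coeff a 0) hg
    simp only [AddMonoidAlgebra.coeff_single, Finsupp.single_eq_same] at this
    rw [this, hg0]
  rw [OnSpectralCurve, hdet, hlim, ← sub_eq_zero (a := η ^ 2)]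
  have hval : constantCoeff (C η ^ 2 - m ^ 2 * (p ^ 2 + q * r)) =
      η ^ 2 - t ^ 2 * (2 * ξ - 1) ^ 2 / (16 * (Real.pi : ℂ) ^ 2 * (ξ * (ξ - 1))) := by
    simp only [hm, hp, hq, hr, map_sub, map_mul, map_add, map_pow, map_neg, constantCoeff_C, hy0,
      hz0, hyi0]
    field_simp
    ring
  rw [hval]

/-- Both entries of a column of the wave matrix solve the row equations. Since the coefficient of
`u` in the first line of the `t`-equation does not vanish, the leading exponents of `ψ` and `u ψ̃`
agree, so that each line of the Lax pair is an identity between power series. -/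
theorem exists_isRowSolution {T U : Set ℂ} (hT : IsOpen T) (hT0 : (0 : ℂ) ∉ T)
    (hU : IsOpen U) {y z L : ℕ → ℂ → ℂ} (hP : IsFormalPainleve T y z L)
    {S : Fin 2 → Fin 2 → ℕ → ℂ → ℂ → ℂ} (hS : IsWKBSolution T U y z L S) {Y Z : ℂ⟦X⟧}
    (hY0 : constantCoeff Y = -1) (hZ0 : constantCoeff Z = -1 / 8)
    (hYZ : ∀ t ∈ T, ser y t = rescale t⁻¹ Y ∧ ser z t = C t * rescale t⁻¹ Z) (b : Fin 2) :
    (∃ w, IsRowSolution T U 1 (-Z + Y * Z) (Z - Z * Y⁻¹) (-2 * Z + Y * Z + Z * Y⁻¹)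
        (fun ξ => C (1 / 2) + C (1 / ξ) * Z - C (1 / (ξ - 1)) * Z)
        (fun ξ => -C (1 / ξ) * Z + C (1 / (ξ - 1)) * Y * Z) (S 0 b) w) ∧
      ∃ w, IsRowSolution T U (-1) (Z - Z * Y⁻¹) (-Z + Y * Z) (-2 * Z + Y * Z + Z * Y⁻¹)
        (fun ξ => -(C (1 / 2) + C (1 / ξ) * Z - C (1 / (ξ - 1)) * Z))
        (fun ξ => C (1 / ξ) * Z - C (1 / (ξ - 1)) * Z * Y⁻¹) (S 1 b) w := by
  have hne : ∀ τ ∈ T, τ ≠ 0 := fun τ hτ h => hT0 (h ▸ hτ)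
  have hYne : constantCoeff Y ≠ 0 := by rw [hY0]; norm_num
  have hyi : ∀ t ∈ T, (ser y t)⁻¹ = rescale t⁻¹ Y⁻¹ := fun t ht => by
    rw [(hYZ t ht).1, rescale_inv_series hYne]
  have hCt : ∀ t ∈ T, (C (1 / t) * C t : ℂ⟦X⟧) = 1 := fun t ht => by
    rw [← map_mul, one_div, inv_mul_cancel₀ (hne t ht), map_one]
  -- the off-diagonal entries of `𝓡` in scaled form
  have hA : ∀ t ∈ T, C (1 / t) * (-ser z t + ser y t * ser z t) =
      rescale t⁻¹ (-Z + Y * Z) := fun t ht => by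
    rw [(hYZ t ht).1, (hYZ t ht).2]
    simp only [map_add, map_neg, map_mul]
    linear_combination (-(rescale t⁻¹ Z) + rescale t⁻¹ Y * rescale t⁻¹ Z) * hCt t ht
  have hB : ∀ t ∈ T, C (1 / t) * (ser z t - ser z t * (ser y t)⁻¹) =
      rescale t⁻¹ (Z - Z * Y⁻¹) := fun t ht => by
    rw [hyi t ht, (hYZ t ht).2]
    simp only [map_sub, map_mul]
    linear_combination (rescale t⁻¹ Z - rescale t⁻¹ Z * rescale t⁻¹ Y⁻¹) * hCt t ht
  have hG : ∀ t ∈ T, C (-(Real.pi : ℂ)) * dser L t =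
      rescale t⁻¹ (-2 * Z + Y * Z + Z * Y⁻¹) := fun t ht => by
    have h1 := hP.eq_log_u t ht
    rw [hyi t ht, (hYZ t ht).1, (hYZ t ht).2, map_mul] at h1
    have h2 : rescale t⁻¹ (-2 * Z + Y * Z + Z * Y⁻¹) = -2 * rescale t⁻¹ Z +
        rescale t⁻¹ Y * rescale t⁻¹ Z + rescale t⁻¹ Z * rescale t⁻¹ Y⁻¹ := by
      simp only [map_add, map_mul, map_neg, map_ofNat]
    rw [h2]
    linear_combination C (1 / t) * h1 + (-2 * rescale t⁻¹ Z + rescale t⁻¹ Y * rescale t⁻¹ Z +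
      rescale t⁻¹ Z * rescale t⁻¹ Y⁻¹ - C (-(Real.pi : ℂ)) * dser L t) * hCt t ht
  have hhalf : ∀ t, (C (t / 2) : ℂ⟦X⟧) = C t * C (1 / 2) := fun t => by
    rw [← map_mul]; congr 1; ring
  have hLd : ∀ t ∈ T, HasSeriesDerivAt (ser L) (dser L t) t := fun t ht =>
    hasSeriesDerivAt_ser hT hP.differentiableOn_log_u ht
  -- the four scalar equations of the column, in the group algebra
  have t0 : ∀ t ∈ T, ∀ ξ ∈ U,
      (C (-(Real.pi : ℂ)) * mk fun j => deriv (fun τ => S 0 b j τ ξ) t) •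
        formalExp (mk fun j => S 0 b j t ξ) =
      (C (ξ / 2) • (1 : WKBRing)) * formalExp (mk fun j => S 0 b j t ξ) +
        (rescale t⁻¹ (-Z + Y * Z) • formalExp (ser L t)) *
          formalExp (mk fun j => S 1 b j t ξ) := fun t ht ξ hξ => by
    have h := congrFun (congrFun (hS.eq_t t ht ξ hξ) 0) b
    rw [Matrix.mul_apply, Fin.sum_univ_two] at h
    rw [mul_smul, ← hA t ht]
    exact h
  have t1 : ∀ t ∈ T, ∀ ξ ∈ U,
      (C (-(Real.pi : ℂ)) * mk fun j => deriv (fun τ => S 1 b j τ ξ) t) •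
        formalExp (mk fun j => S 1 b j t ξ) =
      (C (-ξ / 2) • (1 : WKBRing)) * formalExp (mk fun j => S 1 b j t ξ) +
        (rescale t⁻¹ (Z - Z * Y⁻¹) • formalExp (-ser L t)) *
          formalExp (mk fun j => S 0 b j t ξ) := fun t ht ξ hξ => by
    have h := congrFun (congrFun (hS.eq_t t ht ξ hξ) 1) b
    rw [Matrix.mul_apply, Fin.sum_univ_two, add_comm] at h
    rw [mul_smul, ← hB t ht]
    exact h
  have x0 : ∀ t ∈ T, ∀ ξ ∈ U,
      (C (-(Real.pi : ℂ)) * mk fun j => deriv (fun x => S 0 b j t x) ξ) •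
        formalExp (mk fun j => S 0 b j t ξ) =
      ((C (t / 2) + C (1 / ξ) * ser z t - C (1 / (ξ - 1)) * ser z t) • (1 : WKBRing)) *
          formalExp (mk fun j => S 0 b j t ξ) +
        ((-C (1 / ξ) * ser z t + C (1 / (ξ - 1)) * ser y t * ser z t) • formalExp (ser L t)) *
          formalExp (mk fun j => S 1 b j t ξ) := fun t ht ξ hξ => by
    have h := congrFun (congrFun (hS.eq_xi t ht ξ hξ) 0) b
    rw [Matrix.mul_apply, Fin.sum_univ_two] at h
    rw [mul_smul]
    exact h
  have x1 : ∀ t ∈ T, ∀ ξ ∈ U,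
      (C (-(Real.pi : ℂ)) * mk fun j => deriv (fun x => S 1 b j t x) ξ) •
        formalExp (mk fun j => S 1 b j t ξ) =
      ((-C (t / 2) - C (1 / ξ) * ser z t + C (1 / (ξ - 1)) * ser z t) • (1 : WKBRing)) *
          formalExp (mk fun j => S 1 b j t ξ) +
        ((C (1 / ξ) * ser z t - C (1 / (ξ - 1)) * ser z t * (ser y t)⁻¹) •
          formalExp (-ser L t)) * formalExp (mk fun j => S 0 b j t ξ) := fun t ht ξ hξ => by
    have h := congrFun (congrFun (hS.eq_xi t ht ξ hξ) 1) b
    rw [Matrix.mul_apply, Fin.sum_univ_two, add_comm] at h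
    rw [mul_smul]
    exact h
  have hA0 : ∀ t, rescale t⁻¹ (-Z + Y * Z) ≠ 0 := fun t h => by
    have := congrArg constantCoeff h
    rw [constantCoeff_rescale, map_add, map_neg, map_mul, hY0, hZ0, map_zero] at this
    norm_num at this
  have hlead : ∀ t ∈ T, ∀ ξ ∈ U, coeff 0 (ser L t) + S 1 b 0 t ξ = S 0 b 0 t ξ :=
    fun t ht ξ hξ => by
      simpa only [coeff_mk] using smul_formalExp_row_coeff_zero (hA0 t) (t0 t ht ξ hξ)
  have T0 := fun t ht ξ hξ => smul_formalExp_row (t0 t ht ξ hξ)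
  have T1 := fun t ht ξ hξ => smul_formalExp_row (t1 t ht ξ hξ)
  refine ⟨⟨_, isRowSolution_of_lax hT hU (Λ := ser L) (Λ' := dser L) (F := S 1 b)
      (hS.differentiableOn 0 b) (hS.differentiableOn 1 b) hLd ?_ hlead ?_ ?_ ?_⟩,
    ⟨_, isRowSolution_of_lax hT hU (Λ := fun t => -ser L t) (Λ' := fun t => -dser L t)
      (F := S 0 b) (hS.differentiableOn 1 b) (hS.differentiableOn 0 b)
      (fun t ht => (hLd t ht).neg) ?_ ?_ ?_ ?_ ?_⟩⟩
  · intro t ht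
    rw [hG t ht, map_one, one_mul]
  · intro t ht ξ hξ
    rw [T0 t ht ξ hξ, one_mul]
  · intro t ht ξ hξ
    rw [T1 t ht ξ hξ, neg_one_mul]
  · intro t ht ξ hξ
    rw [smul_formalExp_row (x0 t ht ξ hξ), (hYZ t ht).1, (hYZ t ht).2]
    simp only [map_add, map_sub, map_neg, map_mul, rescale_C, hhalf t]
    ring
  · intro t ht
    rw [mul_neg, hG t ht, map_neg, map_one, neg_one_mul]
  · intro t ht ξ hξ
    rw [← hlead t ht ξ hξ, map_neg, neg_add_cancel_left]
  · intro t ht ξ hξ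
    rw [T1 t ht ξ hξ, neg_one_mul]
  · intro t ht ξ hξ
    rw [T0 t ht ξ hξ, neg_neg, neg_neg, one_mul]
  · intro t ht ξ hξ
    rw [smul_formalExp_row (x1 t ht ξ hξ), hyi t ht, (hYZ t ht).2]
    simp only [map_add, map_sub, map_neg, map_mul, rescale_C, hhalf t]
    ring

theorem SingularOnlyAt.div_const_add {P U : Set ℂ} (hU : IsOpen U) {f g : ℂ → ℂ} {d c : ℂ}
    (hf : SingularOnlyAt P f U) (hg : ∀ ξ ∈ U, g ξ = f ξ / d + c) : SingularOnlyAt P g U := by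
  intro a ha b γ hγ
  have h := ((hf a ha b γ hγ).const_mul d⁻¹).add (.const c)
  refine h.congr ?_
  filter_upwards [hU.mem_nhds ha] with x hx
  rw [hg x hx, div_eq_inv_mul]

end PainleveFive

theorem mainTheorem2
    (T U : Set ℂ) (hT : IsOpen T) (hTc : IsConnected T) (hT0 : (0 : ℂ) ∉ T)
    (hU : IsOpen U) (hUc : IsConnected U) (hU0 : (0 : ℂ) ∉ U) (hU1 : (1 : ℂ) ∉ U)
    (y z L : ℕ → ℂ → ℂ) (hP : PainleveFive.IsFormalPainleve T y z L)
    (S : Fin 2 → Fin 2 → ℕ → ℂ → ℂ → ℂ) (hS : PainleveFive.IsWKBSolution T U y z L S) :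
    -- the spectral curve, with its double zero at `ξ = 1/2`
    (∀ t ∈ T, ∀ ξ : ℂ, ξ ≠ 0 → ξ ≠ 1 → ∀ Y : ℂ,
      PainleveFive.OnSpectralCurve y z L t ξ Y ↔
        Y ^ 2 = t ^ 2 * (2 * ξ - 1) ^ 2 / (16 * (Real.pi : ℂ) ^ 2 * (ξ * (ξ - 1)))) ∧
    ∀ a b : Fin 2,
      -- the `ξ`-derivative of the leading term is a branch of the spectral curve ...
      (∀ t ∈ T, ∀ ξ ∈ U,
        PainleveFive.OnSpectralCurve y z L t ξ (deriv (fun x => S a b 0 t x) ξ)) ∧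
      -- ... hence plus or minus any given holomorphic branch
      (∀ t ∈ T, ∀ Y : ℂ → ℂ, DifferentiableOn ℂ Y U →
        (∀ ξ ∈ U, PainleveFive.OnSpectralCurve y z L t ξ (Y ξ)) →
        (∀ ξ ∈ U, deriv (fun x => S a b 0 t x) ξ = Y ξ) ∨
          (∀ ξ ∈ U, deriv (fun x => S a b 0 t x) ξ = -Y ξ)) ∧
      -- the `t`-dependence `ψ_k(t, ξ) = ψ_k(ξ) / t^k` up to constants, with `k = j - 1`
      -- and the location of the singularities of all `ψ_k`
      (∃ (s : ℕ → ℂ → ℂ) (c : ℕ → ℂ),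
        (∀ j, ∀ t ∈ T, ∀ ξ ∈ U, S a b j t ξ = s j ξ / t ^ ((j : ℤ) - 1) + c j) ∧
        ∀ j, PainleveFive.SingularOnlyAt {0, 1} (s j) U) ∧
      ∀ j, ∀ t ∈ T, PainleveFive.SingularOnlyAt {0, 1} (fun ξ => S a b j t ξ) U := by
  have hne : ∀ τ ∈ T, τ ≠ 0 := fun τ hτ h => hT0 (h ▸ hτ)
  have hξ0 : ∀ ξ ∈ U, ξ ≠ 0 := fun ξ hξ h => hU0 (h ▸ hξ)
  have hξ1 : ∀ ξ ∈ U, ξ ≠ 1 := fun ξ hξ h => hU1 (h ▸ hξ)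
  obtain ⟨Y, Z, hY0, hZ0, hY1, hZ1, hYZ⟩ := hP.homogeneous hT hTc.nonempty hT0
  have hcurve : ∀ t ∈ T, ∀ ξ : ℂ, ξ ≠ 0 → ξ ≠ 1 → ∀ η : ℂ,
      PainleveFive.OnSpectralCurve y z L t ξ η ↔
        η ^ 2 = t ^ 2 * (2 * ξ - 1) ^ 2 / (16 * (Real.pi : ℂ) ^ 2 * (ξ * (ξ - 1))) :=
    fun t ht ξ h0 h1 η =>
      PainleveFive.onSpectralCurve_iff hY0 hZ0 (hYZ t ht).1 (hYZ t ht).2 h0 h1 η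
  refine ⟨hcurve, fun a b => ?_⟩
  obtain ⟨hc0, hc1⟩ := PainleveFive.isRowCoeff_of_painleve hY0 hZ0 hY1 hZ1
  obtain ⟨⟨w0, hw0⟩, ⟨w1, hw1⟩⟩ := PainleveFive.exists_isRowSolution hT hT0 hU hP hS hY0 hZ0 hYZ b
  have hrow : (∀ t ∈ T, ∀ ξ ∈ U, deriv (fun x => S a b 0 t x) ξ ^ 2 =
      t ^ 2 * (2 * ξ - 1) ^ 2 / (16 * (Real.pi : ℂ) ^ 2 * (ξ * (ξ - 1)))) ∧
      ∃ (s : ℕ → ℂ → ℂ) (c : ℕ → ℂ),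
        (∀ j, ∀ t ∈ T, ∀ ξ ∈ U, S a b j t ξ = s j ξ / t ^ ((j : ℤ) - 1) + c j) ∧
        ∀ j, PainleveFive.SingularOnlyAt {0, 1} (s j) U := by
    fin_cases a
    · exact hw0.separated hT hTc hT0 hU hUc hU0 hU1 hc0
    · exact hw1.separated hT hTc hT0 hU hUc hU0 hU1 hc1
  obtain ⟨hsq, s, c, hs, hsing⟩ := hrow
  refine ⟨fun t ht ξ hξ => (hcurve t ht ξ (hξ0 ξ hξ) (hξ1 ξ hξ) _).2 (hsq t ht ξ hξ),
    fun t ht Y hYd hYc => ?_, ⟨s, c, hs, hsing⟩,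
    fun j t ht => (hsing j).div_const_add hU (hs j t ht)⟩
  have hSd : DifferentiableOn ℂ (fun x => S a b 0 t x) U := fun ξ hξ =>
    (PainleveFive.differentiableAt_slice_right hT hU (hS.differentiableOn a b 0)
      ht hξ).differentiableWithinAt
  have hS'd := (hSd.deriv hU).analyticOnNhd hU
  have hYan := hYd.analyticOnNhd hU
  -- a product of analytic functions on a connected set vanishes only if a factor does
  rcases (hS'd.sub hYan).eq_zero_or_eq_zero_of_mul_eq_zero (hS'd.add hYan) (fun ξ hξ => by
      have h1 := (hcurve t ht ξ (hξ0 ξ hξ) (hξ1 ξ hξ) _).1 (hYc ξ hξ)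
      have h2 := hsq t ht ξ hξ
      simp only [Pi.sub_apply, Pi.add_apply]
      linear_combination h2 - h1) hUc.isPreconnected with h | h
  · exact Or.inl fun ξ hξ => sub_eq_zero.1 (h ξ hξ)
  · exact Or.inr fun ξ hξ => eq_neg_of_add_eq_zero_left (h ξ hξ)
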